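/- Let $\overline{\mathbb Q}$ be the field of algebraic numbers, let $n\ge 0$ be an integer, and let $\mathbb G_m^n=(\overline{\mathbb Q}^{\,*})^n$. For $\alpha=(\alpha_1,\dots,\alpha_n)\in\mathbb G_m^n$ let $h(\alpha)$ be the absolute logarithmic Weil height of the projective point $(1:\alpha_1:\cdots:\alpha_n)$, that is $$h(\alpha)=\sum_{v}\frac{[K_v:\mathbb Q_v]}{[K:\mathbb Q]}\log\max\{1,|\alpha_1|_v,\dots,|\alpha_n|_v\},\qquad K=\mathbb Q(\alpha_1,\dots,\alpha_n),$$ the sum being over all places $v$ of $K$; for a nonzero polynomial $F$ with coefficients in a number field, let $h(F)$ be the absolute logarithmic Weil height of the projective point whose coordinates are the coefficients of $F$. Let $k\subset\overline{\mathbb Q}$ be a number field with ring of integers $\mathcal O_k$, and write $k[\mathbf x]=k[x_1,\dots,x_n]$. Let $k[\mathbf x]_{\le L}$ be the space of polynomials of total degree at most $L$. A polynomial $F$ vanishes at $\beta$ with multiplicity at least $T$ if $$\frac{1}{\lambda_1!\cdots\lambda_n!}\,\frac{\partial^{\lambda_1+\cdots+\lambda_n}F}{\partial x_1^{\lambda_1}\cdots\partial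 x_n^{\lambda_n}}(\beta)=0\qquad\text{for all }\lambda\in\mathbb N^n\text{ with }\lambda_1+\cdots+\lambda_n<T.$$ For a set $S\subset\overline{\mathbb Q}^n$ put $$E_k(S,L,T)=\{F\in k[\mathbf x]_{\le L} : F\text{ vanishes at every }\beta\in S\text{ with multiplicity at least }T\}.$$ Let $\theta>0$ be a real number, let $\mathbf E$ be a finite nonempty set of points $\alpha\in\mathbb G_m^n$ with $h(\alpha)\le\theta$, and let $L,T\ge 0$ be integers. If $E_k(\mathbf E,L,T)\neq\{0\}$, then there is a nonzero polynomial $F\in E_k(\mathbf E,L,T)\cap\mathcal O_k[\mathbf x]$ such that $$h(F)\le\frac{r}{N-r}\bigl((T+n-1)\log(L+1)+L\theta\bigr)+\log c_k,$$ where $$N=\dim_k k[\mathbf x]_{\le L},\qquad r=N-\dim_k E_k(\mathbf E,L,T),\qquad c_k=\left(\Bigl(\frac2\pi\Bigr)^{s}\sqrt{|\Delta_k|}\right)^{1/[k:\mathbb Q]},$$ $s$ is the number of complex places of $k$ and $\Delta_k$ is its discriminant. -/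

import Mathlib

noncomputable section

namespace SiegelTorus

/-- The field of algebraic numbers. -/
abbrev QBar : Type := AlgebraicClosure ℚ

/-- The points of the torus `𝔾_m^n` over the algebraic numbers. -/
abbrev Torus (n : ℕ) : Type := Fin n → QBarˣ

/-- The affine coordinates of a point of the torus. -/
def Torus.coords {n : ℕ} (α : Torus n) : Fin n → QBar := fun i => (α i : QBar)

/-- The absolute logarithmic Weil height of the projective point with coordinates `x` in a number
field `K`, i.e. `∑_v [K_v : ℚ_v] / [K : ℚ] * log (max_i |x_i|_v)`. -/
def absLogHeight (K : Type*) [Field K] [NumberField K] {ι : Type*} (x : ι → K) : ℝ :=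
  Height.logHeight x / (Module.finrank ℚ K : ℝ)

/-- The number field `ℚ(α₁, …, αₙ)` generated by the coordinates of a point. -/
abbrev Torus.field {n : ℕ} (α : Torus n) : IntermediateField ℚ QBar :=
  IntermediateField.adjoin ℚ (Set.range α.coords)

instance Torus.finiteDimensional_field {n : ℕ} (α : Torus n) :
    FiniteDimensional ℚ α.field :=
  IntermediateField.finiteDimensional_adjoin
    (fun x _ => ((AlgebraicClosure.isAlgebraic ℚ).isAlgebraic x).isIntegral)

instance Torus.numberField_field {n : ℕ} (α : Torus n) : NumberField α.field where

/-- The coordinates of `α`, as elements of `ℚ(α₁, …, αₙ)`. -/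
def Torus.gen {n : ℕ} (α : Torus n) (i : Fin n) : α.field :=
  ⟨α.coords i, IntermediateField.subset_adjoin ℚ _ ⟨i, rfl⟩⟩

/-- The height of a point of the torus: the height of `(1 : α₁ : ⋯ : αₙ)`. -/
def Torus.height {n : ℕ} (α : Torus n) : ℝ :=
  absLogHeight α.field (Fin.cons 1 α.gen : Fin (n + 1) → α.field)

/-- The height of a polynomial over a number field: the height of the projective point given by
its coefficients (only the nonzero ones matter). -/
def polyHeight {k : Type*} [Field k] [NumberField k] {n : ℕ}
    (F : MvPolynomial (Fin n) k) : ℝ :=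
  absLogHeight k (fun m : F.support => F.coeff m)

/-- The iterated partial derivative `∂^(l₁ + ⋯ + lₙ) / ∂x₁^l₁ ⋯ ∂xₙ^lₙ`. -/
def partialDeriv {k : Type*} [Field k] {n : ℕ} (l : Fin n → ℕ) :
    Module.End k (MvPolynomial (Fin n) k) :=
  (List.ofFn fun i : Fin n =>
    ((MvPolynomial.pderiv i).toLinearMap : Module.End k (MvPolynomial (Fin n) k)) ^ l i).prod

/-- The divided derivative `D_l = (1 / (l₁! ⋯ lₙ!)) ∂^l / ∂x^l`. -/
def dividedDeriv {k : Type*} [Field k] {n : ℕ} (l : Fin n → ℕ) :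
    Module.End k (MvPolynomial (Fin n) k) :=
  (∏ i, ((l i).factorial : k))⁻¹ • partialDeriv l

/-- `F` vanishes at `x` with multiplicity at least `T`. -/
def VanishesToOrder {k A : Type*} [Field k] [CommRing A] [Algebra k A] {n : ℕ}
    (F : MvPolynomial (Fin n) k) (x : Fin n → A) (T : ℕ) : Prop :=
  ∀ l : Fin n → ℕ, ∑ i, l i < T → MvPolynomial.aeval x (dividedDeriv l F) = 0

/-- The space `E_k(S, L, T)` of polynomials over `k` of total degree at most `L` vanishing at
every point of `S` with multiplicity at least `T`. -/
def vanishingSpace (k : Type*) {A : Type*} [Field k] [CommRing A] [Algebra k A] {n : ℕ}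
    (S : Set (Fin n → A)) (L T : ℕ) : Submodule k (MvPolynomial (Fin n) k) where
  carrier := {F | F ∈ MvPolynomial.restrictTotalDegree (Fin n) k L ∧
    ∀ x ∈ S, VanishesToOrder F x T}
  add_mem' := fun ha hb => ⟨Submodule.add_mem _ ha.1 hb.1, fun x hx l hl => by
    rw [map_add, map_add, ha.2 x hx l hl, hb.2 x hx l hl, add_zero]⟩
  zero_mem' := ⟨Submodule.zero_mem _, fun x hx l hl => by rw [map_zero, map_zero]⟩
  smul_mem' := fun c F hF => ⟨Submodule.smul_mem _ c hF.1, fun x hx l hl => by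
    rw [map_smul, map_smul, hF.2 x hx l hl, smul_zero]⟩

/-- `N`, the dimension of the space of polynomials of total degree at most `L`. -/
def dimPoly (k : Type*) [Field k] (n L : ℕ) : ℕ :=
  Module.finrank k (MvPolynomial.restrictTotalDegree (Fin n) k L)

/-- `r`, the codimension of `E_k(S, L, T)` in the space of polynomials of total degree at most
`L` (a subtraction of natural numbers that never truncates). -/
def codimVanishing (k : Type*) {A : Type*} [Field k] [CommRing A] [Algebra k A] {n : ℕ}
    (S : Set (Fin n → A)) (L T : ℕ) : ℕ :=
  dimPoly k n L - Module.finrank k (vanishingSpace k S L T)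

/-- The field constant `c_k = ((2 / π)^s √|Δ_k|)^(1 / [k : ℚ])`. -/
def fieldConst (k : Type*) [Field k] [NumberField k] : ℝ :=
  ((2 / Real.pi) ^ NumberField.InfinitePlace.nrComplexPlaces k *
    Real.sqrt |(NumberField.discr k : ℝ)|) ^ (1 / (Module.finrank ℚ k : ℝ))

end SiegelTorus

end

/-! The vanishing conditions are linear in the `N` coefficients and cut out a subspace `V` of `k ^
N` of dimension `M = N - r`. What is needed is a Siegel lemma that produces an integral vector of
`V` with small sup norm at every infinite place, with a bound in terms of the heights of the
equations, even though these have coefficients in an extension `K` of `k`.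

Choose coordinates so that `V = {(-B u, u)}` with `B` an `r × M` matrix over `k`. The admissible `u`
form the kernel of `u ↦ B u mod 𝓞 k ^ r`, whose image has finite order `q`. Instead of bounding
sections of a cube, average: the box of radius `ρ` in all `N` coordinates, sheared by `(u, w) ↦ (u,
B u + w)`, projects into a set `S`, so some fibre has volume at least vol(box) / vol(`S`).
Blichfeldt's principle on that fibre, with lattice points sorted into `q` classes, gives two points
whose difference is admissible and lies in the box of radius `2ρ` together with its image under `B`.

At each place take `R` such that `(R | R B)` has orthonormal rows. By Cauchy–Schwarz `R` maps `S`
into a box of radius `√N ρ`, so vol(`S`) costs a factor `√N` per equation and the inverse of `τ = ∏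
|det R_v|` (with multiplicities). Select `r` independent equations `(C | D)`, `D = C B`. Hadamard's
inequality bounds `|det C|` by `|det R|` times the Euclidean row lengths, and an index computation
bounds `q ^ [K:k]` by the norm of `det C` divided by the norms of ideals containing the rows. Hence
`q / τ` is at most the product of the row heights (to suitable powers): `τ` disappears, and no
information on `B` is needed.

For divided derivatives at `α` each row has height at most `√N (L+1)^(T-1) exp(Lθ)`. The two factors
`√N` multiply to `N ≤ (L+1)^n`, which gives the exponent `T+n-1`; the constant `c_k` is the ratio of
the covolume of `𝓞 k` to the volume of the unit box, normalised. -/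

noncomputable section

namespace SiegelTorus

/-! ### Geometry of numbers: Blichfeldt's principle and averaging over fibres -/

section Geometry

open MeasureTheory Module NumberField NumberField.mixedEmbedding
open scoped ENNReal Pointwise

/-- A refinement of Blichfeldt's theorem: if the volume of `s` exceeds `card C` times the covolume,
then two distinct lattice points with the same value under `g : L → C` have overlapping translates
of `s`. -/
theorem exists_ne_map_eq_not_disjoint_vadd {E L C : Type*} [MeasurableSpace E] {μ : Measure E}
    {F s : Set E} [AddGroup L] [Countable L] [AddAction L E] [MeasurableSpace L]
    [MeasurableVAdd L E] [VAddInvariantMeasure L E μ] (fund : IsAddFundamentalDomain L F μ)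
    (hs : NullMeasurableSet s μ) [Finite C] (g : L → C) (h : Nat.card C * μ F < μ s) :
    ∃ x y : L, x ≠ y ∧ g x = g y ∧ ¬ Disjoint (x +ᵥ s) (y +ᵥ s) := by
  contrapose! h
  have := Fintype.ofFinite C
  calc μ s = ∑' x : L, μ ((x +ᵥ s) ∩ F) := fund.measure_eq_tsum s
    _ = ∑' p : Σ c : C, {x // g x = c}, μ (((p.2 : L) +ᵥ s) ∩ F) :=
      ((Equiv.sigmaFiberEquiv g).tsum_eq (fun x : L => μ ((x +ᵥ s) ∩ F))).symm
    _ = ∑' (c : C) (x : {x // g x = c}), μ (((x : L) +ᵥ s) ∩ F) := ENNReal.tsum_sigma' _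
    -- Inside one fibre of `g` the translates are pairwise disjoint, so their traces on `F` together
    -- measure at most `μ F`.
    _ ≤ ∑' _ : C, μ F := by
      refine ENNReal.tsum_le_tsum fun c => ?_
      rw [← measure_iUnion₀]
      · exact measure_mono (Set.iUnion_subset fun _ => Set.inter_subset_right)
      · intro x y hxy
        refine Disjoint.aedisjoint (Disjoint.mono inf_le_left inf_le_left (h x y ?_ ?_))
        · exact fun e => hxy (Subtype.ext e)
        · rw [x.2, y.2]
      · exact fun x => (hs.vadd _).inter fund.nullMeasurableSet
    _ = Nat.card C * μ F := by
      rw [tsum_fintype, Finset.sum_const, nsmul_eq_mul, Nat.card_eq_fintype_card, Finset.card_univ]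

/-- If every fibre over `v` of the sheared product `{(u, φ u + w) | u ∈ A, w ∈ B}` has measure at
most `c`, then the product has measure at most `c` times that of the image. -/
theorem measure_mul_le_of_forall_fiber_le {U W : Type*} [MeasurableSpace U] [MeasurableSpace W]
    [AddCommGroup W] [MeasurableAdd₂ W] [MeasurableNeg W] (μ : Measure U) (ν : Measure W) [SFinite μ]
    [SFinite ν] [ν.IsAddLeftInvariant] {A : Set U} {B S : Set W} {φ : U → W} {c : ℝ≥0∞}
    (hA : MeasurableSet A) (hB : MeasurableSet B) (hφ : Measurable φ) (hS : MeasurableSet S)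
    (hsub : ∀ u ∈ A, ∀ w ∈ B, φ u + w ∈ S) (hc : ∀ v, μ {u | u ∈ A ∧ v - φ u ∈ B} ≤ c) :
    μ A * ν B ≤ c * ν S := by
  have hZ : MeasurableSet {p : U × W | p.1 ∈ A ∧ p.2 - φ p.1 ∈ B} := by
    have h1 : Measurable fun p : U × W => p.2 - φ p.1 := by
      simp_rw [sub_eq_add_neg]
      exact measurable_snd.add (hφ.comp measurable_fst).neg
    exact (measurable_fst hA).inter (h1 hB)
  -- Fubini in both orders: the slice over `u ∈ A` is a translate of `B`, while the slice over `v`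
  -- is empty off `S` and has measure at most `c` on it.
  have e1 : (μ.prod ν) {p : U × W | p.1 ∈ A ∧ p.2 - φ p.1 ∈ B} = μ A * ν B := by
    rw [Measure.prod_apply hZ, mul_comm, ← lintegral_indicator_const hA]
    refine lintegral_congr fun u => ?_
    by_cases hu : u ∈ A
    · rw [Set.indicator_of_mem hu]
      convert measure_preimage_add ν (-φ u) B using 2
      ext v
      simp [hu, sub_eq_add_neg, add_comm]
    · rw [Set.indicator_of_notMem hu]
      convert measure_empty (μ := ν)
      ext v
      simp [hu]
  have e2 : (μ.prod ν) {p : U × W | p.1 ∈ A ∧ p.2 - φ p.1 ∈ B} ≤ c * ν S := by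
    rw [Measure.prod_apply_symm hZ, ← lintegral_indicator_const hS c]
    refine lintegral_mono fun v => ?_
    by_cases hv : v ∈ S
    · rw [Set.indicator_of_mem hv]
      exact hc v
    · rw [Set.indicator_of_notMem hv, nonpos_iff_eq_zero]
      convert measure_empty (μ := μ)
      ext u
      simp only [Set.mem_preimage, Set.mem_ofPred_eq, Set.mem_empty_iff_false, iff_false, not_and]
      intro hu hb
      apply hv
      simpa using hsub u hu _ hb
  exact e1 ▸ e2

/-- The lattice `𝓞 k ^ I` in a power of the mixed space: a basis. -/
def latticeBasisPi (k I : Type*) [Field k] [NumberField k] [Fintype I] :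
    Basis (Σ _ : I, Module.Free.ChooseBasisIndex ℤ (𝓞 k)) ℝ (I → mixedSpace k) :=
  Pi.basis fun _ : I => latticeBasis k

open scoped Classical in
theorem volume_fundamentalDomain_latticeBasisPi (k I : Type*) [Field k] [NumberField k]
    [Fintype I] :
    volume (ZSpan.fundamentalDomain (latticeBasisPi k I)) =
      volume (ZSpan.fundamentalDomain (latticeBasis k)) ^ Fintype.card I := by
  have : ZSpan.fundamentalDomain (latticeBasisPi k I) =
      Set.univ.pi fun _ : I => ZSpan.fundamentalDomain (latticeBasis k) := by
    ext x
    simp [ZSpan.mem_fundamentalDomain, latticeBasisPi, Set.mem_pi, Pi.basis_repr, Sigma.forall]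
  rw [this, volume_pi_pi, Finset.prod_const, Finset.card_univ]

theorem exists_of_mem_span_latticeBasisPi {k I : Type*} [Field k] [NumberField k]
    [Fintype I] {x : I → mixedSpace k}
    (hx : x ∈ Submodule.span ℤ (Set.range (latticeBasisPi k I))) :
    ∃ u : I → 𝓞 k, ∀ i, x i = mixedEmbedding k (u i) := by
  classical
  have key : ∀ i, x i ∈ mixedEmbedding.integerLattice k := by
    intro i
    induction hx using Submodule.span_induction with
    | mem y hy =>
      obtain ⟨⟨j, a⟩, rfl⟩ := hy
      by_cases h : i = j
      · subst h
        simp only [latticeBasisPi, Pi.basis_apply, Pi.single_eq_same]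
        rw [← span_latticeBasis]
        exact Submodule.subset_span ⟨a, rfl⟩
      · simp [latticeBasisPi, Pi.basis_apply, Pi.single_eq_of_ne h]
    | zero => exact Submodule.zero_mem _
    | add y z _ _ hy hz => exact Submodule.add_mem _ hy hz
    | smul a y _ hy => exact Submodule.smul_mem _ _ hy
  choose u hu using fun i => LinearMap.mem_range.mp (key i)
  exact ⟨u, fun i => (hu i).symm⟩

theorem sub_mem_convexBodyLT {k : Type*} [Field k] {ρ : NNReal} {x y : mixedSpace k}
    (hx : x ∈ convexBodyLT k fun _ => ρ) (hy : y ∈ convexBodyLT k fun _ => ρ) :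
    x - y ∈ convexBodyLT k fun _ => 2 * ρ := by
  simp only [Set.mem_prod, Set.mem_pi, Set.mem_univ, mem_ball_zero_iff, forall_true_left,
    Prod.fst_sub, Prod.snd_sub, Pi.sub_apply, NNReal.coe_mul, NNReal.coe_ofNat] at *
  refine ⟨fun w => ?_, fun w => ?_⟩
  · linarith [norm_sub_le (x.1 w) (y.1 w), hx.1 w, hy.1 w]
  · linarith [norm_sub_le (x.2 w) (y.2 w), hx.2 w, hy.2 w]

open scoped Classical in
/-- The geometry of numbers input: if the box of radius `ρ` in `(k ⊗ ℝ) ^ (I ⊕ J)` is large compared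
to the image `S` of its shear, then the module of `u ∈ 𝓞 k ^ I` with `B u` integral contains a
nonzero element such that `u` and `B u` lie in the box of radius `2 ρ`. -/
theorem exists_integral_vector_of_volume_lt {k I J C : Type*} [Field k] [NumberField k] [Fintype I]
    [Fintype J] [Finite C] (B : Matrix J I k) (ρ : NNReal) {S : Set (J → mixedSpace k)}
    (hS : MeasurableSet S)
    (hsub : ∀ u : I → mixedSpace k, (∀ i, u i ∈ convexBodyLT k fun _ => ρ) →
      ∀ w : J → mixedSpace k, (∀ j, w j ∈ convexBodyLT k fun _ => ρ) →
        (B.map (mixedEmbedding k)).mulVec u + w ∈ S)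
    (g : (I → 𝓞 k) → C)
    (hg : ∀ u u', g u = g u' → ∀ j, ∃ z : 𝓞 k,
      (B.mulVec fun i => ((u - u') i : k)) j = (z : k))
    (h : Nat.card C * volume (ZSpan.fundamentalDomain (latticeBasis k)) ^ Fintype.card I * volume S
      < volume (convexBodyLT k fun _ => ρ) ^ Fintype.card I *
        volume (convexBodyLT k fun _ => ρ) ^ Fintype.card J) :
    ∃ (u : I → 𝓞 k) (z : J → 𝓞 k), u ≠ 0 ∧ (B.mulVec fun i => (u i : k)) = (fun j => (z j : k)) ∧
      (∀ (v : InfinitePlace k) i, v (u i) < 2 * ρ) ∧ ∀ (v : InfinitePlace k) j, v (z j) < 2 * ρ := by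
  have hbox : MeasurableSet (convexBodyLT k fun _ => ρ) :=
    (MeasurableSet.univ_pi fun _ => measurableSet_ball).prod
      (MeasurableSet.univ_pi fun _ => measurableSet_ball)
  have hE : (volume : Measure (mixedSpace k)).IsAddHaarMeasure := inferInstance
  have hE' : SigmaFinite (volume : Measure (mixedSpace k)) := inferInstance
  have hE'' : BorelSpace (mixedSpace k) := inferInstance
  have hE3 : SecondCountableTopology (mixedSpace k) := inferInstance
  have hI : (volume : Measure (I → mixedSpace k)).IsAddHaarMeasure := inferInstance
  have hI' : OpensMeasurableSpace (I → mixedSpace k) := inferInstance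
  have hI'' : SFinite (volume : Measure (I → mixedSpace k)) := inferInstance
  have hJ : (volume : Measure (J → mixedSpace k)).IsAddHaarMeasure := inferInstance
  set φ : (I → mixedSpace k) → (J → mixedSpace k) :=
    fun u => (B.map (mixedEmbedding k)).mulVec u with hφ
  have hφc : Continuous φ := by
    refine continuous_pi fun j => ?_
    simp only [hφ, Matrix.mulVec, dotProduct]
    fun_prop
  -- Averaging finds a large fibre over some uncontrolled `v`. The fibre need not be centred at the
  -- origin; taking differences recentres it, at the price of the factor 2.
  obtain ⟨v, hv⟩ : ∃ v, Nat.card C * volume (ZSpan.fundamentalDomain (latticeBasisPi k I)) <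
      volume {u | u ∈ (Set.univ.pi fun _ : I => convexBodyLT k fun _ => ρ) ∧
        v - φ u ∈ Set.univ.pi fun _ : J => convexBodyLT k fun _ => ρ} := by
    by_contra! hcon
    have := measure_mul_le_of_forall_fiber_le volume volume
      (MeasurableSet.univ_pi fun _ : I => hbox) (MeasurableSet.univ_pi fun _ : J => hbox)
      hφc.measurable hS (fun u hu w hw => hsub u (by simpa [Set.mem_pi] using hu) w
        (by simpa [Set.mem_pi] using hw)) hcon
    rw [volume_pi_pi, volume_pi_pi, Finset.prod_const, Finset.prod_const, Finset.card_univ,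
      Finset.card_univ, volume_fundamentalDomain_latticeBasisPi] at this
    exact absurd this (not_le.mpr h)
  have hfib : MeasurableSet {u | u ∈ (Set.univ.pi fun _ : I => convexBodyLT k fun _ => ρ) ∧
        v - φ u ∈ Set.univ.pi fun _ : J => convexBodyLT k fun _ => ρ} :=
    (MeasurableSet.univ_pi fun _ : I => hbox).inter
      ((continuous_const.sub hφc).measurable (MeasurableSet.univ_pi fun _ : J => hbox))
  have hcount : Countable (Submodule.span ℤ (Set.range (latticeBasisPi k I))).toAddSubgroup := by
    change Countable (Submodule.span ℤ (Set.range (latticeBasisPi k I)))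
    infer_instance
  choose c hc using fun x : (Submodule.span ℤ (Set.range (latticeBasisPi k I))).toAddSubgroup =>
    exists_of_mem_span_latticeBasisPi x.2
  obtain ⟨x, y, hxy, hgxy, hdis⟩ := exists_ne_map_eq_not_disjoint_vadd
    (ZSpan.isAddFundamentalDomain' (latticeBasisPi k I) volume) hfib.nullMeasurableSet
    (fun x => g (c x)) hv
  obtain ⟨p, ⟨a, ha, rfl⟩, ⟨b, hb, hab⟩⟩ := Set.not_disjoint_iff.mp hdis
  choose z hz using hg _ _ hgxy
  have hab' : ∀ i, mixedEmbedding k ((c x - c y) i : k) = b i - a i := by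
    intro i
    have := congrFun hab i
    simp only [Pi.sub_apply, map_sub, ← hc]
    change y.1 i + b i = x.1 i + a i at this
    rw [sub_eq_sub_iff_add_eq_add, ← this, add_comm]
  -- The shift `v` cancels: `B (b - a) = (v - φ a) - (v - φ b)`, a difference of two points of the
  -- box.
  have hz' : ∀ j, mixedEmbedding k (z j : k) = (v - φ a) j - (v - φ b) j := by
    intro j
    have h1 : ∀ j i, mixedEmbedding k (B j i * ((c x - c y) i : k)) =
        mixedEmbedding k (B j i) * b i - mixedEmbedding k (B j i) * a i := fun j i => by
      rw [map_mul, hab', mul_sub]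
    rw [← hz]
    simp only [Matrix.mulVec, dotProduct, map_sum, h1, Finset.sum_sub_distrib]
    simp only [hφ, Pi.sub_apply, Matrix.mulVec, dotProduct, Matrix.map_apply]
    abel
  refine ⟨c x - c y, z, ?_, funext hz, fun w i => ?_, fun w j => ?_⟩
  · intro h0
    apply hxy
    ext i : 2
    rw [hc, hc, sub_eq_zero.mp h0]
  · have := (convexBodyLT_mem k _).mp
      (hab' i ▸ sub_mem_convexBodyLT (hb.1 i trivial) (ha.1 i trivial)) w
    simpa using this
  · have := (convexBodyLT_mem k _).mp
      (hz' j ▸ sub_mem_convexBodyLT (ha.2 j trivial) (hb.2 j trivial)) w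
    simpa using this

end Geometry

/-! ### Hadamard's inequality and orthonormalisation at one place -/

section Archimedean

open Matrix
open scoped ComplexOrder MatrixOrder

/-- **Hadamard's inequality** for complex matrices. -/
theorem norm_det_sq_le_prod_sum_norm_sq {J : Type*} [Fintype J] [DecidableEq J]
    (Z : Matrix J J ℂ) : ‖Z.det‖ ^ 2 ≤ ∏ j, ∑ i, ‖Z j i‖ ^ 2 := by
  by_cases hrow : ∃ j, ∑ i, ‖Z j i‖ ^ 2 = 0
  · obtain ⟨j, hj⟩ := hrow
    have hz : ∀ i, Z j i = 0 := by
      intro i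
      have := (Finset.sum_eq_zero_iff_of_nonneg fun i _ => sq_nonneg ‖Z j i‖).mp hj i
        (Finset.mem_univ i)
      simpa using this
    rw [Matrix.det_eq_zero_of_row_eq_zero j hz, norm_zero, zero_pow two_ne_zero]
    exact Finset.prod_nonneg fun j _ => Finset.sum_nonneg fun i _ => sq_nonneg _
  push Not at hrow
  have hpos : ∀ j, 0 < ∑ i, ‖Z j i‖ ^ 2 := fun j =>
    lt_of_le_of_ne (Finset.sum_nonneg fun i _ => sq_nonneg _) (hrow j).symm
  set s : J → ℝ := fun j => Real.sqrt (∑ i, ‖Z j i‖ ^ 2) with hs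
  have hspos : ∀ j, 0 < s j := fun j => Real.sqrt_pos.mpr (hpos j)
  have hssq : ∀ j, s j ^ 2 = ∑ i, ‖Z j i‖ ^ 2 := fun j => Real.sq_sqrt (hpos j).le
  set W : Matrix J J ℂ := Matrix.of fun j i => ((s j : ℂ))⁻¹ * Z j i with hW
  have hdet : Z.det = (∏ j, (s j : ℂ)) * W.det := by
    rw [hW, Matrix.det_mul_column, ← mul_assoc, ← Finset.prod_mul_distrib]
    rw [Finset.prod_eq_one fun j _ => mul_inv_cancel₀ (by exact_mod_cast (hspos j).ne'), one_mul]
  have hPSD : (W * Wᴴ).PosSemidef := Matrix.posSemidef_self_mul_conjTranspose W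
  have htr : ∑ i, hPSD.isHermitian.eigenvalues i = Fintype.card J := by
    have h1 := hPSD.isHermitian.trace_eq_sum_eigenvalues
    have h2 : (W * Wᴴ).trace = (Fintype.card J : ℂ) := by
      rw [Matrix.trace, ← Finset.card_univ, Finset.cast_card]
      refine Finset.sum_congr rfl fun j _ => ?_
      simp only [Matrix.diag_apply, Matrix.mul_apply, Matrix.conjTranspose_apply, hW,
        Matrix.of_apply, Complex.star_def, Complex.mul_conj, Complex.normSq_eq_norm_sq, norm_mul,
        norm_inv, Complex.norm_real, Real.norm_eq_abs, abs_of_pos (hspos j), mul_pow]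
      rw [← Complex.ofReal_sum, ← Finset.mul_sum, ← hssq, inv_pow,
        inv_mul_cancel₀ (pow_pos (hspos j) 2).ne', Complex.ofReal_one]
    rw [h2] at h1
    have h3 : ((∑ i, hPSD.isHermitian.eigenvalues i : ℝ) : ℂ) = ((Fintype.card J : ℝ) : ℂ) := by
      rw [Complex.ofReal_sum, Complex.ofReal_natCast, h1]
      rfl
    exact Complex.ofReal_injective h3
  -- The rows of `W` are unit vectors, so the eigenvalues of `W Wᴴ` sum to `card J`; multiplying the
  -- inequalities `x ≤ exp (x - 1)` bounds their product by 1.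
  have hW1 : ‖W.det‖ ^ 2 ≤ 1 := by
    have h1 : ((‖W.det‖ ^ 2 : ℝ) : ℂ) = ((∏ i, hPSD.isHermitian.eigenvalues i : ℝ) : ℂ) := by
      have := hPSD.isHermitian.det_eq_prod_eigenvalues
      rw [Matrix.det_mul, Matrix.det_conjTranspose, Complex.star_def, Complex.mul_conj,
        Complex.normSq_eq_norm_sq] at this
      rw [this]
      push_cast
      rfl
    rw [Complex.ofReal_injective h1]
    calc ∏ i, hPSD.isHermitian.eigenvalues i
        ≤ ∏ i, Real.exp (hPSD.isHermitian.eigenvalues i - 1) :=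
          Finset.prod_le_prod (fun i _ => hPSD.eigenvalues_nonneg i) fun i _ => by
            linarith [Real.add_one_le_exp (hPSD.isHermitian.eigenvalues i - 1)]
      _ = 1 := by
          rw [← Real.exp_sum, Finset.sum_sub_distrib, htr]
          simp
  calc ‖Z.det‖ ^ 2 = (∏ j, s j ^ 2) * ‖W.det‖ ^ 2 := by
        rw [hdet, norm_mul, mul_pow, norm_prod, ← Finset.prod_pow]
        simp [abs_of_pos (hspos _)]
    _ ≤ (∏ j, s j ^ 2) * 1 := by gcongr
    _ = _ := by rw [mul_one]; exact Finset.prod_congr rfl fun j _ => hssq j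

variable {𝕜 : Type*} [RCLike 𝕜] {I J : Type*} [Fintype I] [Fintype J] [DecidableEq J]

/-- There is a square matrix `R` such that the rows of `(R | R B)` are orthonormal. -/
theorem exists_normalizer (B : Matrix J I 𝕜) :
    ∃ R : Matrix J J 𝕜, R * (1 + B * Bᴴ) * Rᴴ = 1 := by
  have hG : (1 + B * Bᴴ).PosDef :=
    Matrix.PosDef.add_posSemidef Matrix.PosDef.one (Matrix.posSemidef_self_mul_conjTranspose B)
  obtain ⟨P, hP⟩ := CStarAlgebra.nonneg_iff_eq_star_mul_self.mp hG.posSemidef.nonneg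
  rw [Matrix.star_eq_conjTranspose] at hP
  have hu : IsUnit P.det := by
    have := hG.det_pos.ne'
    rw [hP, Matrix.det_mul] at this
    exact isUnit_iff_ne_zero.mpr (right_ne_zero_of_mul this)
  have hu' : IsUnit Pᴴ.det := by rw [Matrix.det_conjTranspose]; exact hu.star
  refine ⟨(Pᴴ)⁻¹, ?_⟩
  rw [hP, Matrix.conjTranspose_nonsing_inv, Matrix.conjTranspose_conjTranspose, ← mul_assoc,
    Matrix.nonsing_inv_mul _ hu', one_mul, Matrix.mul_nonsing_inv _ hu]

theorem normalizer_det_ne_zero {B : Matrix J I 𝕜} {R : Matrix J J 𝕜}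
    (hR : R * (1 + B * Bᴴ) * Rᴴ = 1) : R.det ≠ 0 := by
  intro h
  have := congrArg Matrix.det hR
  rw [Matrix.det_mul, Matrix.det_mul, h, Matrix.det_one] at this
  simp at this

/-- Row `j` of `(R B | R)` is a unit vector and `(u, w)` has Euclidean length below `√(card I + card
J) ρ`, so Cauchy–Schwarz applies. This is the first of the two factors `√N` in the final bound. -/
theorem norm_normalizer_mulVec_lt {B : Matrix J I 𝕜} {R : Matrix J J 𝕜}
    (hR : R * (1 + B * Bᴴ) * Rᴴ = 1) {ρ : ℝ} {u : I → 𝕜} {w : J → 𝕜} (hu : ∀ i, ‖u i‖ < ρ)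
    (hw : ∀ j, ‖w j‖ < ρ) (j : J) :
    ‖(R *ᵥ (B *ᵥ u + w)) j‖ < Real.sqrt (Fintype.card I + Fintype.card J) * ρ := by
  have hρ : 0 < ρ := (norm_nonneg _).trans_lt (hw j)
  set f : I ⊕ J → ℝ := Sum.elim (fun i => ‖(R * B) j i‖) (fun i => ‖R j i‖) with hf
  set g : I ⊕ J → ℝ := Sum.elim (fun i => ‖u i‖) (fun i => ‖w i‖) with hg
  have hf1 : ∑ x, f x ^ 2 = 1 := by
    have h1 : R * Rᴴ + (R * B) * (R * B)ᴴ = 1 := by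
      rw [← hR, Matrix.conjTranspose_mul, mul_add, mul_one, add_mul]
      simp only [Matrix.mul_assoc]
    have h2 := congrFun (congrFun h1 j) j
    rw [Matrix.add_apply, Matrix.mul_apply, Matrix.mul_apply (M := R * B), Matrix.one_apply_eq]
      at h2
    simp only [Matrix.conjTranspose_apply, RCLike.star_def, RCLike.mul_conj] at h2
    rw [Fintype.sum_sum_type]
    simp only [hf, Sum.elim_inl, Sum.elim_inr]
    have h3 : ((∑ i, ‖R j i‖ ^ 2 + ∑ i, ‖(R * B) j i‖ ^ 2 : ℝ) : 𝕜) = ((1 : ℝ) : 𝕜) := by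
      push_cast
      exact h2
    rw [add_comm]
    exact_mod_cast h3
  have hg1 : ∑ x, g x ^ 2 < (Fintype.card I + Fintype.card J) * ρ ^ 2 := by
    calc ∑ x, g x ^ 2 < ∑ _x : I ⊕ J, ρ ^ 2 := by
          refine Finset.sum_lt_sum_of_nonempty ⟨Sum.inr j, Finset.mem_univ _⟩ fun x _ => ?_
          rcases x with x | x
          · exact pow_lt_pow_left₀ (hu x) (norm_nonneg _) two_ne_zero
          · exact pow_lt_pow_left₀ (hw x) (norm_nonneg _) two_ne_zero
      _ = _ := by simp
  have hle : ‖(R *ᵥ (B *ᵥ u + w)) j‖ ≤ ∑ x, f x * g x := by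
    rw [Matrix.mulVec_add, Matrix.mulVec_mulVec, Fintype.sum_sum_type]
    refine (norm_add_le _ _).trans (add_le_add ?_ ?_)
    · exact (norm_sum_le _ _).trans_eq (Finset.sum_congr rfl fun i _ => norm_mul _ _)
    · exact (norm_sum_le _ _).trans_eq (Finset.sum_congr rfl fun i _ => norm_mul _ _)
  refine hle.trans_lt (lt_of_pow_lt_pow_left₀ 2 (by positivity) ?_)
  calc (∑ x, f x * g x) ^ 2 ≤ (∑ x, f x ^ 2) * ∑ x, g x ^ 2 :=
        Finset.sum_mul_sq_le_sq_mul_sq _ _ _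
    _ < (Fintype.card I + Fintype.card J) * ρ ^ 2 := by rw [hf1, one_mul]; exact hg1
    _ = _ := by rw [mul_pow, Real.sq_sqrt (by positivity)]

/-- Put `P = R⁻¹`. Since `P Pᴴ = 1 + B Bᴴ`, the rows of `C P` have the same lengths as those of `(C
| C B)`, and Hadamard's inequality for `C P` is the claim. The map `φ` serves real places, where `R`
and `B` are real but `C` may be complex. -/
theorem norm_det_le_norm_normalizer_det_mul {B : Matrix J I 𝕜} {R : Matrix J J 𝕜}
    (hR : R * (1 + B * Bᴴ) * Rᴴ = 1) (φ : 𝕜 →+* ℂ) (hφ : ∀ x, φ (star x) = star (φ x))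
    (hn : ∀ x, ‖φ x‖ = ‖x‖) (C : Matrix J J ℂ) :
    ‖C.det‖ ≤ ‖R.det‖ *
      ∏ j, Real.sqrt (∑ i, ‖C j i‖ ^ 2 + ∑ i, ‖(C * B.map φ) j i‖ ^ 2) := by
  have hu : IsUnit R.det := isUnit_iff_ne_zero.mpr (normalizer_det_ne_zero hR)
  have hu' : IsUnit Rᴴ.det := by rw [Matrix.det_conjTranspose]; exact hu.star
  have hG : 1 + B * Bᴴ = R⁻¹ * (R⁻¹)ᴴ := by
    have h1 : R⁻¹ * (R * (1 + B * Bᴴ) * Rᴴ) * (Rᴴ)⁻¹ = R⁻¹ * (Rᴴ)⁻¹ := by rw [hR, mul_one]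
    rw [Matrix.conjTranspose_nonsing_inv, ← h1, ← mul_assoc, ← mul_assoc,
      Matrix.nonsing_inv_mul _ hu, one_mul, mul_assoc, Matrix.mul_nonsing_inv _ hu', mul_one]
  set P := (R⁻¹).map φ with hP
  have hPP : P * Pᴴ = 1 + B.map φ * (B.map φ)ᴴ := by
    have h2 := congrArg (fun M : Matrix J J 𝕜 => M.map φ) hG
    rw [Matrix.map_mul, Matrix.conjTranspose_map φ hφ, ← hP, Matrix.map_add φ (map_add φ),
      Matrix.map_mul, Matrix.conjTranspose_map φ hφ, Matrix.map_one φ (map_zero φ) (map_one φ)] at h2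
    exact h2.symm
  have hZZ : C * P * (C * P)ᴴ = C * Cᴴ + (C * B.map φ) * (C * B.map φ)ᴴ := by
    rw [Matrix.conjTranspose_mul, mul_assoc C, ← mul_assoc P, hPP, Matrix.conjTranspose_mul]
    simp only [Matrix.add_mul, Matrix.mul_add, Matrix.one_mul, Matrix.mul_assoc]
  have hdet : ‖C.det‖ = ‖R.det‖ * ‖(C * P).det‖ := by
    have h3 : R.det * R⁻¹.det = 1 := by
      rw [← Matrix.det_mul, Matrix.mul_nonsing_inv _ hu, Matrix.det_one]
    have h4 : P.det = φ R⁻¹.det := by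
      rw [hP, RingHom.map_det, RingHom.mapMatrix_apply]
    rw [Matrix.det_mul, norm_mul, h4, hn, mul_left_comm, ← norm_mul, h3, norm_one, mul_one]
  have hdiag : ∀ j, ∑ i, ‖(C * P) j i‖ ^ 2 = ∑ i, ‖C j i‖ ^ 2 + ∑ i, ‖(C * B.map φ) j i‖ ^ 2 := by
    intro j
    have h5 := congrFun (congrFun hZZ j) j
    rw [Matrix.add_apply, Matrix.mul_apply, Matrix.mul_apply (M := C),
      Matrix.mul_apply (M := C * B.map φ)] at h5
    simp only [Matrix.conjTranspose_apply, RCLike.star_def, RCLike.mul_conj] at h5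
    exact_mod_cast h5
  rw [hdet]
  gcongr
  refine le_of_sq_le_sq ?_ (Finset.prod_nonneg fun j _ => Real.sqrt_nonneg _)
  rw [← Finset.prod_pow]
  refine (norm_det_sq_le_prod_sum_norm_sq _).trans_eq (Finset.prod_congr rfl fun j _ => ?_)
  rw [Real.sq_sqrt (by positivity), hdiag]

end Archimedean

/-! ### The projected box over all infinite places -/

section ShearedBox

open MeasureTheory Module NumberField NumberField.mixedEmbedding NumberField.InfinitePlace Matrix

/-- Multiplication by `z` is block diagonal over the places, with determinant `z_v` at a real and
`|z_v|²` at a complex one. It turns the real determinant of a matrix over the mixed space into a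
product of local absolute values. -/
theorem abs_algebraNorm_mixedSpace {k : Type*} [Field k] [NumberField k] (z : mixedSpace k) :
    |Algebra.norm ℝ z| = mixedEmbedding.norm z := by
  classical
  have h : Algebra.lmul ℝ (mixedSpace k) z = LinearMap.prodMap
      (LinearMap.pi fun v => (Algebra.lmul ℝ ℝ (z.1 v)).comp (LinearMap.proj v))
      (LinearMap.pi fun v => (Algebra.lmul ℝ ℂ (z.2 v)).comp (LinearMap.proj v)) := by
    ext x <;> simp
  rw [Algebra.norm_apply, h, LinearMap.det_prodMap, LinearMap.det_pi, LinearMap.det_pi,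
    mixedEmbedding.norm_apply, prod_eq_prod_mul_prod, abs_mul, Finset.abs_prod, Finset.abs_prod]
  congr 1
  · refine Finset.prod_congr rfl fun v _ => ?_
    rw [← Algebra.norm_apply, normAtPlace_apply_of_isReal v.2, mult_isReal, pow_one,
      Algebra.norm_self]
    rfl
  · refine Finset.prod_congr rfl fun v _ => ?_
    rw [← Algebra.norm_apply, normAtPlace_apply_of_isComplex v.2, mult_isComplex,
      Algebra.norm_complex_apply, Complex.normSq_eq_norm_sq, abs_of_nonneg (sq_nonneg _)]

/-- The component of the mixed space at a real place. -/
def mixedSpaceReal {k : Type*} [Field k] (v : {v : InfinitePlace k // IsReal v}) :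
    mixedSpace k →+* ℝ :=
  (Pi.evalRingHom _ v).comp (RingHom.fst _ _)

/-- The component of the mixed space at a complex place. -/
def mixedSpaceComplex {k : Type*} [Field k] (v : {v : InfinitePlace k // IsComplex v}) :
    mixedSpace k →+* ℂ :=
  (Pi.evalRingHom _ v).comp (RingHom.snd _ _)

/-- A place fixes an embedding only up to conjugation; conjugating `C` as well leaves every absolute
value unchanged. -/
theorem norm_normalizer_bound_conj {I J : Type*} [Fintype I] [Fintype J] [DecidableEq J]
    (B : Matrix J I ℂ) (t : ℝ)
    (h : ∀ C : Matrix J J ℂ, ‖C.det‖ ≤ t *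
      ∏ j, Real.sqrt (∑ i, ‖C j i‖ ^ 2 + ∑ i, ‖(C * B) j i‖ ^ 2)) (C : Matrix J J ℂ) :
    ‖C.det‖ ≤ t *
      ∏ j, Real.sqrt (∑ i, ‖C j i‖ ^ 2 + ∑ i, ‖(C * B.map (starRingEnd ℂ)) j i‖ ^ 2) := by
  have h1 := h (C.map (starRingEnd ℂ))
  have h2 : (C.map (starRingEnd ℂ)).det = starRingEnd ℂ C.det := by
    rw [RingHom.map_det, RingHom.mapMatrix_apply]
  have h3 : C.map (starRingEnd ℂ) * B = (C * B.map (starRingEnd ℂ)).map (starRingEnd ℂ) := by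
    rw [Matrix.map_mul, Matrix.map_map]
    congr 1
    ext a b
    simp
  rw [h2, h3] at h1
  simpa using h1

open scoped Classical in
/-- The image of the box of radius `ρ` in `(k ⊗ ℝ) ^ (I ⊕ J)` under `(u, w) ↦ B u + w` lies in a set
whose volume is controlled, up to the local factors `t v`, by a box of radius `√N ρ`; the local
factors are bounded below in terms of the determinant of any matrix `C`. -/
theorem exists_shear_bound {k I J : Type*} [Field k] [NumberField k] [Fintype I]
    [Fintype J] (B : Matrix J I k) :
    ∃ t : InfinitePlace k → ℝ, (∀ v, 0 < t v) ∧
      (∀ (σ : k →+* ℂ) (C : Matrix J J ℂ), ‖C.det‖ ≤ t (mk σ) *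
        ∏ j, Real.sqrt (∑ i, ‖C j i‖ ^ 2 + ∑ i, ‖(C * B.map σ) j i‖ ^ 2)) ∧
      ∀ ρ : NNReal, ∃ S : Set (J → mixedSpace k), MeasurableSet S ∧
        (∀ u : I → mixedSpace k, (∀ i, u i ∈ convexBodyLT k fun _ => ρ) →
          ∀ w : J → mixedSpace k, (∀ j, w j ∈ convexBodyLT k fun _ => ρ) →
            (B.map (mixedEmbedding k)).mulVec u + w ∈ S) ∧
        volume S = ENNReal.ofReal (∏ v, t v ^ v.mult)⁻¹ *
          volume (convexBodyLT k fun _ => NNReal.sqrt (Fintype.card I + Fintype.card J) * ρ) ^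
            Fintype.card J := by
  choose Rr hRr using fun v : {v : InfinitePlace k // IsReal v} =>
    exists_normalizer (B.map (embedding_of_isReal v.2))
  choose Rc hRc using fun v : {v : InfinitePlace k // IsComplex v} =>
    exists_normalizer (B.map v.1.embedding)
  set R : Matrix J J (mixedSpace k) :=
    Matrix.of fun i j => (fun v => Rr v i j, fun v => Rc v i j) with hR
  have hRr' : ∀ v, R.map (mixedSpaceReal v) = Rr v := fun v => rfl
  have hRc' : ∀ v, R.map (mixedSpaceComplex v) = Rc v := fun v => rfl
  have hdetr : ∀ v : {v : InfinitePlace k // IsReal v}, normAtPlace v.1 R.det = ‖(Rr v).det‖ := by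
    intro v
    rw [normAtPlace_apply_of_isReal v.2, ← hRr', ← RingHom.mapMatrix_apply, ← RingHom.map_det]
    rfl
  have hdetc : ∀ v : {v : InfinitePlace k // IsComplex v},
      normAtPlace v.1 R.det = ‖(Rc v).det‖ := by
    intro v
    rw [normAtPlace_apply_of_isComplex v.2, ← hRc', ← RingHom.mapMatrix_apply, ← RingHom.map_det]
    rfl
  have hpos : ∀ v, 0 < normAtPlace v R.det := by
    intro v
    rcases isReal_or_isComplex v with hv | hv
    · rw [hdetr ⟨v, hv⟩]
      exact norm_pos_iff.mpr (normalizer_det_ne_zero (hRr ⟨v, hv⟩))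
    · rw [hdetc ⟨v, hv⟩]
      exact norm_pos_iff.mpr (normalizer_det_ne_zero (hRc ⟨v, hv⟩))
  -- The local normalisers are glued to one matrix `R` over the mixed space. `S` is the preimage
  -- under `R` of the box of radius `√N ρ`, so its volume carries the inverse of the product of the
  -- `|det R_v|`.
  refine ⟨fun v => normAtPlace v R.det, hpos, ?_, fun ρ => ?_⟩
  · intro σ C
    have key : ∀ v : InfinitePlace k, ∀ C : Matrix J J ℂ, ‖C.det‖ ≤ normAtPlace v R.det *
        ∏ j, Real.sqrt (∑ i, ‖C j i‖ ^ 2 + ∑ i, ‖(C * B.map v.embedding) j i‖ ^ 2) := by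
      intro v C
      rcases isReal_or_isComplex v with hv | hv
      · rw [hdetr ⟨v, hv⟩]
        have := norm_det_le_norm_normalizer_det_mul (hRr ⟨v, hv⟩) Complex.ofRealHom
          (fun x => by simp) (fun x => by simp) C
        rw [Matrix.map_map] at this
        convert this using 10
        ext a
        simp
      · rw [hdetc ⟨v, hv⟩]
        have := norm_det_le_norm_normalizer_det_mul (hRc ⟨v, hv⟩) (RingHom.id ℂ)
          (fun x => by simp) (fun x => by simp) C
        rw [Matrix.map_map] at this
        exact this
    rcases embedding_mk_eq σ with h | h
    · have := key (mk σ) C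
      rwa [h] at this
    · refine norm_normalizer_bound_conj (B.map (mk σ).embedding) _ (key (mk σ)) C |>.trans_eq ?_
      rw [Matrix.map_map, h]
      congr! 10
      ext a
      simp [ComplexEmbedding.conjugate_coe_eq]
  · have hE : (volume : Measure (mixedSpace k)).IsAddHaarMeasure := inferInstance
    have hE' : SigmaFinite (volume : Measure (mixedSpace k)) := inferInstance
    have hE'' : BorelSpace (mixedSpace k) := inferInstance
    have hE3 : SecondCountableTopology (mixedSpace k) := inferInstance
    have hJ : (volume : Measure (J → mixedSpace k)).IsAddHaarMeasure := inferInstance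
    have hJ' : BorelSpace (J → mixedSpace k) := inferInstance
    set ρ' := NNReal.sqrt (Fintype.card I + Fintype.card J) * ρ with hρ'
    have hbox : MeasurableSet (convexBodyLT k fun _ => ρ') :=
      (MeasurableSet.univ_pi fun _ => measurableSet_ball).prod
        (MeasurableSet.univ_pi fun _ => measurableSet_ball)
    set f : (J → mixedSpace k) →ₗ[ℝ] (J → mixedSpace k) := (Matrix.toLin' R).restrictScalars ℝ
      with hf
    have hfdet : |LinearMap.det f| = ∏ v, normAtPlace v R.det ^ v.mult := by
      rw [hf, LinearMap.det_restrictScalars, LinearMap.det_toLin', abs_algebraNorm_mixedSpace,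
        mixedEmbedding.norm_apply]
    have hdpos : 0 < ∏ v, normAtPlace v R.det ^ v.mult :=
      Finset.prod_pos fun v _ => pow_pos (hpos v) _
    refine ⟨f ⁻¹' (Set.univ.pi fun _ => convexBodyLT k fun _ => ρ'), ?_, ?_, ?_⟩
    · exact f.continuous_of_finiteDimensional.measurable (MeasurableSet.univ_pi fun _ => hbox)
    · intro u hu w hw
      simp only [Set.mem_prod, Set.mem_pi, Set.mem_univ, mem_ball_zero_iff, forall_true_left] at hu hw
      have hfx : ∀ x, f x = R *ᵥ x := fun x => Matrix.toLin'_apply R x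
      rw [Set.mem_preimage, hfx]
      simp only [Set.mem_prod, Set.mem_pi, Set.mem_univ, mem_ball_zero_iff, forall_true_left]
      intro j
      have hρR : (ρ' : ℝ) = Real.sqrt (Fintype.card I + Fintype.card J) * ρ := by
        rw [hρ']
        push_cast
        rfl
      have hmap : ∀ {A : Type _} [Field A] (π : mixedSpace k →+* A),
          π ((R *ᵥ (B.map (mixedEmbedding k) *ᵥ u + w)) j) = (R.map π *ᵥ
            ((B.map (π.comp (mixedEmbedding k))) *ᵥ (fun i => π (u i)) + fun i => π (w i))) j := by
        intro A _ π
        simp [Matrix.mulVec, dotProduct, map_sum, map_mul, map_add]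
      rw [hρR]
      refine ⟨fun v => ?_, fun v => ?_⟩
      · have := norm_normalizer_mulVec_lt (hRr v) (fun i => (hu i).1 v) (fun i => (hw i).1 v) j
        rw [← hRr'] at this
        exact (congrArg norm (hmap (mixedSpaceReal v))).trans_lt this
      · have := norm_normalizer_mulVec_lt (hRc v) (fun i => (hu i).2 v) (fun i => (hw i).2 v) j
        rw [← hRc'] at this
        exact (congrArg norm (hmap (mixedSpaceComplex v))).trans_lt this
    · rw [Measure.addHaar_preimage_linearMap, abs_inv, hfdet, volume_pi_pi, Finset.prod_const,
        Finset.card_univ]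
      exact abs_pos.mp (hfdet ▸ hdpos)

end ShearedBox

/-! ### The index of the admissible vectors, computed over the extension field -/

section Index

open Module NumberField TensorProduct

theorem natCard_quotTensor (k K : Type*) [Field k] [NumberField k] [Field K] [NumberField K]
    [Algebra k K] (p : Ideal (𝓞 k)) :
    Nat.card (𝓞 K ⊗[𝓞 k] (𝓞 k ⧸ p)) = Nat.card (𝓞 k ⧸ p) ^ finrank (𝓞 k) (𝓞 K) := by
  have h := Ideal.absNorm_algebraMap (R := 𝓞 k) (S := 𝓞 K) p
  rw [Ideal.absNorm_apply, Ideal.absNorm_apply, Submodule.cardQuot_apply,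
    Submodule.cardQuot_apply] at h
  rw [← h, Nat.card_congr (tensorQuotEquivQuotSMul (𝓞 K) p).toEquiv]
  have e : (p • (⊤ : Submodule (𝓞 k) (𝓞 K))) =
      (p.map (algebraMap (𝓞 k) (𝓞 K))).restrictScalars (𝓞 k) := Ideal.smul_top_eq_map p
  rw [e]
  rfl

theorem natCard_eq_of_exact {A M₁ M₂ M₃ : Type*} [Ring A] [AddCommGroup M₁] [AddCommGroup M₂]
    [AddCommGroup M₃] [Module A M₁] [Module A M₂] [Module A M₃] (f : M₁ →ₗ[A] M₂)
    (g : M₂ →ₗ[A] M₃) (hf : Function.Injective f) (hg : Function.Surjective g)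
    (hfg : Function.Exact f g) : Nat.card M₂ = Nat.card M₃ * Nat.card M₁ := by
  rw [Submodule.card_eq_card_quotient_mul_card (LinearMap.ker g),
    Nat.card_congr (g.quotKerEquivOfSurjective hg).toEquiv, hfg.linearMap_ker_eq,
    ← Nat.card_congr (LinearEquiv.ofInjective f hf).toEquiv, mul_comm]

/-- Dévissage: finitely generated modules are built by extensions from quotients by primes, where
the claim is the norm of an extended ideal, and both sides are multiplicative in exact sequences
because `𝓞 K` is flat. Finiteness is an implication because the induction runs over all finitely
generated modules. -/
theorem natCard_tensor_aux (k K : Type*) [Field k] [NumberField k] [Field K] [NumberField K]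
    [Algebra k K] (X : Type*) [AddCommGroup X] [Module (𝓞 k) X] (hfg : Module.Finite (𝓞 k) X) :
    Finite X → Finite (𝓞 K ⊗[𝓞 k] X) ∧
      Nat.card (𝓞 K ⊗[𝓞 k] X) = Nat.card X ^ finrank (𝓞 k) (𝓞 K) := by
  induction hfg using IsNoetherianRing.induction_on_isQuotientEquivQuotientPrime with
  | subsingleton N =>
    intro _
    have : Subsingleton (𝓞 K ⊗[𝓞 k] N) := inferInstance
    exact ⟨inferInstance, by simp⟩
  | quotient N p e =>
    intro hN
    have e' : 𝓞 K ⊗[𝓞 k] N ≃ₗ[𝓞 k] 𝓞 K ⊗[𝓞 k] (𝓞 k ⧸ p.1) := LinearEquiv.lTensor _ e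
    have hcard : Nat.card (𝓞 K ⊗[𝓞 k] N) = Nat.card N ^ finrank (𝓞 k) (𝓞 K) := by
      rw [Nat.card_congr e'.toEquiv, natCard_quotTensor, Nat.card_congr e.toEquiv]
    refine ⟨?_, hcard⟩
    exact Nat.finite_of_card_ne_zero (hcard ▸ pow_ne_zero _ Nat.card_pos.ne')
  | exact N₁ N₂ N₃ f g hf hg hfg h1 h3 =>
    intro hN₂
    have hN₁ : Finite N₁ := Finite.of_injective f hf
    have hN₃ : Finite N₃ := Finite.of_surjective g hg
    obtain ⟨f1, c1⟩ := h1 hN₁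
    obtain ⟨f3, c3⟩ := h3 hN₃
    have hinj := Module.Flat.lTensor_preserves_injective_linearMap (M := 𝓞 K) f hf
    have hsurj := LinearMap.lTensor_surjective (𝓞 K) hg
    have hex := lTensor_exact (𝓞 K) hfg hg
    have hc := natCard_eq_of_exact _ _ hinj hsurj hex
    have hcard : Nat.card (𝓞 K ⊗[𝓞 k] N₂) = Nat.card N₂ ^ finrank (𝓞 k) (𝓞 K) := by
      rw [hc, c1, c3, ← mul_pow, natCard_eq_of_exact _ _ hf hg hfg]
    exact ⟨Nat.finite_of_card_ne_zero (hcard ▸ pow_ne_zero _ Nat.card_pos.ne'), hcard⟩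

/-- Base change multiplies the length of a finite module by the degree. -/
theorem natCard_tensor (k K : Type*) [Field k] [NumberField k] [Field K] [NumberField K]
    [Algebra k K] (X : Type*) [AddCommGroup X] [Module (𝓞 k) X] [Finite X] :
    Nat.card (𝓞 K ⊗[𝓞 k] X) = Nat.card X ^ finrank k K := by
  have h := (natCard_tensor_aux k K X inferInstance inferInstance).2
  rwa [← IsFractionRing.finrank_eq (𝓞 k) k (𝓞 K) K] at h

/-- The vectors with integral entries. -/
def integralVectors (k J : Type*) [Field k] [NumberField k] : Submodule (𝓞 k) (J → k) :=
  LinearMap.range ((Algebra.linearMap (𝓞 k) k).compLeft J)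

theorem mem_integralVectors {k J : Type*} [Field k] [NumberField k] {x : J → k} :
    x ∈ integralVectors k J ↔ ∃ z : J → 𝓞 k, ∀ j, x j = z j := by
  simp only [integralVectors, LinearMap.mem_range, funext_iff]
  exact exists_congr fun z => forall_congr' fun j => eq_comm

/-- The map `u ↦ B u` modulo integral vectors. -/
def residueMap {k I J : Type*} [Field k] [NumberField k] [Fintype I] (B : Matrix J I k) :
    (I → 𝓞 k) →ₗ[𝓞 k] (J → k) ⧸ integralVectors k J :=
  (integralVectors k J).mkQ ∘ₗ (Matrix.mulVecLin B).restrictScalars (𝓞 k) ∘ₗ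
    (Algebra.linearMap (𝓞 k) k).compLeft I

theorem residueMap_eq_iff {k I J : Type*} [Field k] [NumberField k] [Fintype I]
    (B : Matrix J I k) (u u' : I → 𝓞 k) : residueMap B u = residueMap B u' ↔
      ∃ z : J → 𝓞 k, ∀ j, (B.mulVec fun i => ((u - u') i : k)) j = z j := by
  rw [← sub_eq_zero, ← map_sub, ← mem_integralVectors]
  simp only [residueMap, LinearMap.comp_apply, Submodule.mkQ_apply]
  rw [Submodule.Quotient.mk_eq_zero]
  rfl

/-- The norm of a common denominator `b` of the entries of `B` is a multiple of `b`, hence an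
integer killing the image. The image is thus a finitely generated torsion group. -/
instance finite_range_residueMap {k I J : Type*} [Field k] [NumberField k] [Fintype I] [Finite J]
    (B : Matrix J I k) : Finite (LinearMap.range (residueMap B)) := by
  obtain ⟨b, hb⟩ := IsLocalization.exist_integer_multiples_of_finite (nonZeroDivisors (𝓞 k))
    (fun p : J × I => B p.1 p.2)
  choose m hm using hb
  have hb0 : (b : 𝓞 k) ≠ 0 := nonZeroDivisors.ne_zero b.2
  have hfin : Module.Finite ℤ (LinearMap.range (residueMap B)) :=
    Module.Finite.trans (𝓞 k) _
  refine Module.finite_of_fg_torsion _ ?_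
  rintro ⟨x, u, rfl⟩
  set n := Ideal.absNorm (Ideal.span {(b : 𝓞 k)}) with hn
  have hn0 : n ≠ 0 := by
    rw [hn, Ne, Ideal.absNorm_eq_zero_iff, Ideal.span_singleton_eq_bot]
    exact hb0
  obtain ⟨c, hc⟩ := Ideal.mem_span_singleton'.mp (Ideal.absNorm_mem (Ideal.span {(b : 𝓞 k)}))
  refine ⟨⟨(n : ℤ), mem_nonZeroDivisors_of_ne_zero (by exact_mod_cast hn0)⟩, ?_⟩
  ext
  change (n : ℤ) • residueMap B u = 0
  rw [natCast_zsmul, ← map_nsmul, ← map_zero (residueMap B), residueMap_eq_iff]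
  refine ⟨fun j => ∑ i, c * m (j, i) * u i, fun j => ?_⟩
  simp only [Matrix.mulVec, dotProduct, sub_zero, Pi.smul_apply]
  push_cast
  refine Finset.sum_congr rfl fun i _ => ?_
  have h1 : (n : k) = (c : k) * (b : 𝓞 k) := by
    rw [← map_mul, hc, map_natCast]
  have h2 := hm (j, i)
  rw [Algebra.smul_def] at h2
  rw [nsmul_eq_mul]
  have h3 : ((m (j, i) : 𝓞 k) : k) = (b : 𝓞 k) * B j i := h2
  linear_combination (B j i * u i) * h1 - (c * u i) * h3

/-- Base change of `k ^ J` modulo integral vectors. -/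
def residueBaseChange (k K J : Type*) [Field k] [NumberField k] [Field K]
    [NumberField K] [Algebra k K] :
    𝓞 K ⊗[𝓞 k] ((J → k) ⧸ integralVectors k J) →ₗ[𝓞 K] (J → K) ⧸ integralVectors K J :=
  LinearMap.liftBaseChange (𝓞 K) <|
    (integralVectors k J).liftQ
      (((integralVectors K J).mkQ.restrictScalars (𝓞 k)) ∘ₗ
        (IsScalarTower.toAlgHom (𝓞 k) k K).toLinearMap.compLeft J) <| by
      rintro x hx
      obtain ⟨z, hz⟩ := mem_integralVectors.mp hx
      rw [LinearMap.mem_ker, LinearMap.comp_apply]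
      simp only [LinearMap.coe_restrictScalars, Submodule.mkQ_apply]
      rw [Submodule.Quotient.mk_eq_zero, mem_integralVectors]
      refine ⟨fun j => algebraMap (𝓞 k) (𝓞 K) (z j), fun j => ?_⟩
      simp only [LinearMap.compLeft_apply, Function.comp_apply, hz]
      rfl

/-- `K ^ J` is the base change of `k ^ J`, so a tensor with integral image is an integral
combination of the `1 ⊗ e_j`, and each `e_j` vanishes modulo integral vectors. -/
theorem residueBaseChange_injective (k K J : Type*) [Field k] [NumberField k] [Field K]
    [NumberField K] [Algebra k K] [Fintype J] [DecidableEq J] :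
    Function.Injective (residueBaseChange k K J) := by
  have hpush : Algebra.IsPushout (𝓞 k) (𝓞 K) k K :=
    Algebra.isPushout_of_isLocalization (nonZeroDivisors (𝓞 k)) k (𝓞 K) K
  have hbc : IsBaseChange (𝓞 K) ((IsScalarTower.toAlgHom (𝓞 k) k K).toLinearMap.compLeft J) :=
    IsBaseChange.finitePow J hpush.out
  rw [injective_iff_map_eq_zero]
  intro t ht
  obtain ⟨t, rfl⟩ := LinearMap.lTensor_surjective (𝓞 K) (integralVectors k J).mkQ_surjective t
  have hcomp : ∀ t : 𝓞 K ⊗[𝓞 k] (J → k),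
      residueBaseChange k K J (LinearMap.lTensor (𝓞 K) (integralVectors k J).mkQ t) =
        (integralVectors K J).mkQ (hbc.equiv t) := by
    intro t
    induction t using TensorProduct.induction_on with
    | zero => simp
    | tmul s x =>
      rw [LinearMap.lTensor_tmul, IsBaseChange.equiv_tmul, map_smul, residueBaseChange,
        LinearMap.liftBaseChange_tmul]
      rfl
    | add x y hx hy => simp only [map_add, hx, hy]
  rw [hcomp, Submodule.mkQ_apply, Submodule.Quotient.mk_eq_zero, mem_integralVectors] at ht
  obtain ⟨z, hz⟩ := ht
  have : t = ∑ j, z j ⊗ₜ[𝓞 k] (Pi.single j 1 : J → k) := by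
    apply hbc.equiv.injective
    rw [map_sum]
    ext j
    rw [hz, Finset.sum_apply, Finset.sum_eq_single j]
    · rw [IsBaseChange.equiv_tmul]
      simp [Algebra.smul_def]
    · intro i _ hij
      rw [IsBaseChange.equiv_tmul]
      simp [Pi.single_eq_of_ne hij.symm]
    · simp
  rw [this, map_sum]
  refine Finset.sum_eq_zero fun j _ => ?_
  rw [LinearMap.lTensor_tmul, Submodule.mkQ_apply, (Submodule.Quotient.mk_eq_zero _).mpr,
    TensorProduct.tmul_zero]
  refine mem_integralVectors.mpr ⟨Pi.single j 1, fun i => ?_⟩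
  by_cases h : i = j
  · subst h; simp
  · simp [Pi.single_eq_of_ne h]

theorem natCard_quotient_range_mulVecLin {K J : Type*} [Field K] [NumberField K] [Fintype J]
    [DecidableEq J] (C : Matrix J J (𝓞 K)) (hC : C.det ≠ 0) :
    Nat.card ((J → 𝓞 K) ⧸ LinearMap.range (Matrix.mulVecLin C)) =
      (Algebra.norm ℤ C.det).natAbs := by
  have hinj : Function.Injective (Matrix.mulVecLin C) :=
    Matrix.mulVec_injective_of_det_ne_zero hC
  have h := Submodule.natAbs_det_equiv ((LinearMap.range (Matrix.mulVecLin C)).restrictScalars ℤ)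
    ((LinearEquiv.ofInjective _ hinj).restrictScalars ℤ)
  have h2 : LinearMap.det ((Matrix.mulVecLin C).restrictScalars ℤ) = Algebra.norm ℤ C.det := by
    rw [LinearMap.det_restrictScalars, ← Matrix.toLin'_apply', LinearMap.det_toLin']
  rw [← h2]
  exact h.symm

/-- Over `K` one has `B = C⁻¹ D`, with `D u` in `𝔅 = ∏ 𝔟 j`. So the base-changed image embeds in
`C⁻¹ 𝔅` modulo integral vectors, that is in `𝔅 / C 𝓞 K ^ J`, of order `|N(det C)| / ∏ N(𝔟 j)`. Base
change raises the order of the image to the power `[K:k]`. -/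
theorem natCard_range_residueMap_le {k K I J : Type*} [Field k] [NumberField k] [Field K]
    [NumberField K] [Algebra k K] [Fintype I] [Fintype J] [DecidableEq J] (B : Matrix J I k)
    (C : Matrix J J (𝓞 K)) (hC : C.det ≠ 0) (D : Matrix J I (𝓞 K)) (𝔟 : J → Ideal (𝓞 K))
    (hCD : D.map (algebraMap (𝓞 K) K) = C.map (algebraMap (𝓞 K) K) * B.map (algebraMap k K))
    (hCb : ∀ j i, C j i ∈ 𝔟 j) (hDb : ∀ j i, D j i ∈ 𝔟 j) :
    Nat.card (LinearMap.range (residueMap B)) ^ finrank k K * ∏ j, Ideal.absNorm (𝔟 j) ≤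
      (Algebra.norm ℤ C.det).natAbs := by
  set H := LinearMap.range (Matrix.mulVecLin C) with hH
  set 𝔅 : Submodule (𝓞 K) (J → 𝓞 K) := Submodule.pi Set.univ 𝔟 with h𝔅
  have hH𝔅 : H ≤ 𝔅 := by
    rintro _ ⟨u, rfl⟩ j -
    exact Ideal.sum_mem _ fun i _ => Ideal.mul_mem_right _ _ (hCb j i)
  set CK := C.map (algebraMap (𝓞 K) K) with hCK
  have hCKdet : IsUnit CK.det := by
    rw [hCK, ← RingHom.mapMatrix_apply, ← RingHom.map_det, isUnit_iff_ne_zero]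
    exact (map_ne_zero_iff _ (FaithfulSMul.algebraMap_injective (𝓞 K) K)).mpr hC
  have hmulK : ∀ u : J → 𝓞 K, CK.mulVec (fun j => (u j : K)) = fun j => ((C.mulVec u j : 𝓞 K) : K) := by
    intro u
    ext j
    simp [hCK, Matrix.mulVec, dotProduct]
  let γ : 𝔅 →ₗ[𝓞 K] (J → K) ⧸ integralVectors K J :=
    (integralVectors K J).mkQ ∘ₗ (Matrix.mulVecLin CK⁻¹).restrictScalars (𝓞 K) ∘ₗ
      (Algebra.linearMap (𝓞 K) K).compLeft J ∘ₗ 𝔅.subtype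
  have hγker : LinearMap.ker γ = H.submoduleOf 𝔅 := by
    ext ⟨x, hx⟩
    rw [LinearMap.mem_ker]
    change (integralVectors K J).mkQ (CK⁻¹.mulVec fun j => (x j : K)) = 0 ↔ x ∈ H
    rw [Submodule.mkQ_apply, Submodule.Quotient.mk_eq_zero, mem_integralVectors]
    constructor
    · rintro ⟨z, hz⟩
      refine ⟨z, ?_⟩
      have h1 : CK.mulVec (CK⁻¹.mulVec fun j => (x j : K)) = CK.mulVec (fun j => (z j : K)) := by
        rw [funext hz]
      rw [Matrix.mulVec_mulVec, Matrix.mul_nonsing_inv _ hCKdet, Matrix.one_mulVec, hmulK] at h1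
      ext j
      exact (congrFun h1 j).symm
    · rintro ⟨z, rfl⟩
      refine ⟨z, fun j => ?_⟩
      simp only [Matrix.mulVecLin_apply]
      rw [← hmulK, Matrix.mulVec_mulVec, Matrix.nonsing_inv_mul _ hCKdet, Matrix.one_mulVec]
  have hrange : ∀ t : 𝓞 K ⊗[𝓞 k] LinearMap.range (residueMap B),
      residueBaseChange k K J (LinearMap.lTensor (𝓞 K) (LinearMap.range (residueMap B)).subtype t) ∈
        LinearMap.range γ := by
    intro t
    induction t using TensorProduct.induction_on with
    | zero => simp
    | add x y hx hy => simp only [map_add]; exact Submodule.add_mem _ hx hy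
    | tmul s x =>
      obtain ⟨_, u, rfl⟩ := x
      rw [LinearMap.lTensor_tmul, residueBaseChange, LinearMap.liftBaseChange_tmul]
      refine Submodule.smul_mem _ _ ⟨⟨D.mulVec fun i => algebraMap (𝓞 k) (𝓞 K) (u i), ?_⟩, ?_⟩
      · intro j _
        exact Ideal.sum_mem _ fun i _ => Ideal.mul_mem_right _ _ (hDb j i)
      · change (integralVectors K J).mkQ (CK⁻¹.mulVec fun j =>
          ((D.mulVec (fun i => algebraMap (𝓞 k) (𝓞 K) (u i)) j : 𝓞 K) : K)) =
            (integralVectors K J).mkQ fun j => algebraMap k K (B.mulVec (fun i => (u i : k)) j)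
        congr 1
        have h1 : (fun j => ((D.mulVec (fun i => algebraMap (𝓞 k) (𝓞 K) (u i)) j : 𝓞 K) : K)) =
            CK.mulVec (fun j => algebraMap k K (B.mulVec (fun i => (u i : k)) j)) := by
          have h2 : (fun j => algebraMap k K (B.mulVec (fun i => (u i : k)) j)) =
              (B.map (algebraMap k K)).mulVec fun i => algebraMap k K (u i) := by
            ext j
            simp [Matrix.mulVec, dotProduct]
          rw [h2, Matrix.mulVec_mulVec, ← hCD]
          ext j
          simp only [Matrix.mulVec, dotProduct, Matrix.map_apply, map_sum, map_mul]
          rfl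
        rw [h1, Matrix.mulVec_mulVec, Matrix.nonsing_inv_mul _ hCKdet, Matrix.one_mulVec]
  have hHcard := natCard_quotient_range_mulVecLin C hC
  have hHindex : H.toAddSubgroup.index = (Algebra.norm ℤ C.det).natAbs := hHcard
  have h𝔅index : 𝔅.toAddSubgroup.index = ∏ j, Ideal.absNorm (𝔟 j) := by
    have h1 : 𝔅.toAddSubgroup.index = Nat.card ((J → 𝓞 K) ⧸ 𝔅) := rfl
    rw [h1, Nat.card_congr (Submodule.quotientPi 𝔟).toEquiv, Nat.card_pi]
    rfl
  have hnorm0 : (Algebra.norm ℤ C.det).natAbs ≠ 0 := by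
    rw [Int.natAbs_ne_zero]
    exact Algebra.norm_ne_zero_iff.mpr hC
  have hrel := AddSubgroup.relIndex_mul_index (H := H.toAddSubgroup) (K := 𝔅.toAddSubgroup) hH𝔅
  have hγcard : Nat.card (LinearMap.range γ) = H.toAddSubgroup.relIndex 𝔅.toAddSubgroup := by
    rw [← Nat.card_congr γ.quotKerEquivRange.toEquiv, hγker]
    rfl
  have hfin : Finite (LinearMap.range γ) := by
    apply Nat.finite_of_card_ne_zero
    rw [hγcard]
    intro h0
    rw [h0, zero_mul, hHindex] at hrel
    exact hnorm0 hrel.symm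
  have hle : Nat.card (𝓞 K ⊗[𝓞 k] LinearMap.range (residueMap B)) ≤ Nat.card (LinearMap.range γ) := by
    refine Nat.card_le_card_of_injective (fun t => ⟨_, hrange t⟩) ?_
    intro t t' h
    exact Module.Flat.lTensor_preserves_injective_linearMap _ (Submodule.subtype_injective _)
      (residueBaseChange_injective k K J (congrArg Subtype.val h))
  rw [natCard_tensor, hγcard] at hle
  rw [← hHindex, ← hrel, ← h𝔅index]
  exact Nat.mul_le_mul_right _ hle

end Index

/-! ### Siegel's lemma for a graph -/

section Siegel

open Module NumberField NumberField.InfinitePlace MeasureTheory NumberField.mixedEmbedding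

theorem prod_pow_mult_eq_prod_embeddings {K M : Type*} [Field K] [NumberField K] [CommMonoid M]
    (g : InfinitePlace K → M) : ∏ w, g w ^ w.mult = ∏ σ : K →+* ℂ, g (mk σ) := by
  classical
  rw [← Finset.prod_fiberwise_of_maps_to (g := fun σ : K →+* ℂ => mk σ)
    (fun _ _ => Finset.mem_univ _)]
  refine Finset.prod_congr rfl fun w _ => ?_
  rw [Finset.prod_congr rfl (g := fun _ => g w) fun σ hσ => by rw [(Finset.mem_filter.mp hσ).2],
    Finset.prod_const, card_filter_mk_eq]

open scoped Classical in
theorem card_embeddings_extending {k K : Type*} [Field k] [NumberField k] [Field K] [NumberField K]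
    [Algebra k K] (φ : k →+* ℂ) :
    Finset.card {σ : K →+* ℂ | σ.comp (algebraMap k K) = φ} = finrank k K := by
  let _ : Algebra k ℂ := φ.toAlgebra
  rw [← AlgHom.card k K ℂ, ← Fintype.card_subtype]
  refine Fintype.card_congr ⟨fun σ => { σ.1 with commutes' := fun x => ?_ }, fun f =>
    ⟨f.toRingHom, ?_⟩, fun _ => rfl, fun _ => rfl⟩
  · exact RingHom.congr_fun σ.2 x
  · exact RingHom.ext fun x => f.commutes x

/-- Places counted with multiplicity are complex embeddings, and each embedding of `k` has `[K:k]`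
extensions to `K`. -/
theorem prod_comap_pow_mult {k K M : Type*} [Field k] [NumberField k] [Field K] [NumberField K]
    [Algebra k K] [CommMonoid M] (g : InfinitePlace k → M) :
    ∏ w : InfinitePlace K, g (w.comap (algebraMap k K)) ^ w.mult =
      (∏ v, g v ^ v.mult) ^ finrank k K := by
  classical
  rw [prod_pow_mult_eq_prod_embeddings, prod_pow_mult_eq_prod_embeddings,
    ← Finset.prod_fiberwise_of_maps_to (g := fun σ : K →+* ℂ => σ.comp (algebraMap k K))
      (fun _ _ => Finset.mem_univ _), ← Finset.prod_pow]
  refine Finset.prod_congr rfl fun φ _ => ?_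
  rw [Finset.prod_congr rfl (g := fun _ => g (mk φ)) fun σ hσ => by
    rw [comap_mk, (Finset.mem_filter.mp hσ).2], Finset.prod_const, card_embeddings_extending]

theorem finite_setOf_forall_infinitePlace_le (k : Type*) [Field k] [NumberField k] (R : ℝ) :
    {x : 𝓞 k | ∀ v : InfinitePlace k, v x ≤ R}.Finite := by
  refine ((Embeddings.finite_of_norm_le k ℂ R).preimage
    (RingOfIntegers.coe_injective.injOn)).subset fun x hx => ?_
  exact ⟨RingOfIntegers.isIntegral_coe x, fun φ => hx (mk φ)⟩

/-- The norm of `det C` is a product over the places of `K`, each factor of which `htC` bounds by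
`t` times row lengths. The ideal norms in `hH` cancel those of the index bound, leaving an estimate
in terms of `t` and the row heights only. -/
theorem natCard_range_residueMap_pow_le {k K I J : Type*} [Field k] [NumberField k] [Field K]
    [NumberField K] [Algebra k K] [Fintype I] [Fintype J] [DecidableEq J] (B : Matrix J I k)
    (C : Matrix J J (𝓞 K)) (hC : C.det ≠ 0) (D : Matrix J I (𝓞 K)) (𝔟 : J → Ideal (𝓞 K))
    (hCD : D.map (algebraMap (𝓞 K) K) = C.map (algebraMap (𝓞 K) K) * B.map (algebraMap k K))
    (hCb : ∀ j i, C j i ∈ 𝔟 j) (hDb : ∀ j i, D j i ∈ 𝔟 j) (H : J → ℝ)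
    (hH : ∀ j, ∏ w : InfinitePlace K,
      Real.sqrt (∑ i, w (C j i) ^ 2 + ∑ i, w (D j i) ^ 2) ^ w.mult ≤ H j * Ideal.absNorm (𝔟 j))
    (t : InfinitePlace k → ℝ) (ht : ∀ v, 0 < t v)
    (htC : ∀ (σ : k →+* ℂ) (C : Matrix J J ℂ), ‖C.det‖ ≤ t (mk σ) *
        ∏ j, Real.sqrt (∑ i, ‖C j i‖ ^ 2 + ∑ i, ‖(C * B.map σ) j i‖ ^ 2)) :
    (Nat.card (LinearMap.range (residueMap B)) : ℝ) ^ finrank k K ≤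
      (∏ v, t v ^ v.mult) ^ finrank k K * ∏ j, H j := by
  have hb : ∀ j, 0 < (Ideal.absNorm (𝔟 j) : ℝ) := by
    intro j
    rw [Nat.cast_pos, Nat.pos_iff_ne_zero, Ne, Ideal.absNorm_eq_zero_iff]
    rintro h
    refine hC (Matrix.det_eq_zero_of_row_eq_zero j fun i => ?_)
    simpa [h] using hCb j i
  have hprod : 0 < ∏ j, (Ideal.absNorm (𝔟 j) : ℝ) := Finset.prod_pos fun j _ => hb j
  refine le_of_mul_le_mul_right ?_ hprod
  have h1 := natCard_range_residueMap_le B C hC D 𝔟 hCD hCb hDb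
  have h2 : ((Algebra.norm ℤ C.det).natAbs : ℝ) = ∏ w : InfinitePlace K, w (C.det : K) ^ w.mult := by
    rw [prod_eq_abs_norm, Nat.cast_natAbs, ← Algebra.coe_norm_int]
    push_cast
    rfl
  have h3 : ∀ w : InfinitePlace K, w (C.det : K) ≤ t (w.comap (algebraMap k K)) *
      ∏ j, Real.sqrt (∑ i, w (C j i) ^ 2 + ∑ i, w (D j i) ^ 2) := by
    intro w
    have := htC (w.embedding.comp (algebraMap k K))
      ((C.map (algebraMap (𝓞 K) K)).map w.embedding)
    have hB : B.map (w.embedding.comp (algebraMap k K)) =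
        (B.map (algebraMap k K)).map w.embedding := by
      rw [Matrix.map_map]; rfl
    rw [hB, ← Matrix.map_mul, ← hCD, ← comap_mk, mk_embedding] at this
    have hd : ((C.map (algebraMap (𝓞 K) K)).map w.embedding).det = w.embedding (C.det : K) := by
      rw [← RingHom.mapMatrix_apply, ← RingHom.map_det, ← RingHom.mapMatrix_apply,
        ← RingHom.map_det]
    rw [hd, norm_embedding_eq] at this
    simpa only [Matrix.map_apply, norm_embedding_eq] using this
  calc (Nat.card (LinearMap.range (residueMap B)) : ℝ) ^ finrank k K *
          ∏ j, (Ideal.absNorm (𝔟 j) : ℝ)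
      ≤ ((Algebra.norm ℤ C.det).natAbs : ℝ) := by exact_mod_cast h1
    _ = ∏ w : InfinitePlace K, w (C.det : K) ^ w.mult := h2
    _ ≤ ∏ w : InfinitePlace K, (t (w.comap (algebraMap k K)) *
          ∏ j, Real.sqrt (∑ i, w (C j i) ^ 2 + ∑ i, w (D j i) ^ 2)) ^ w.mult :=
        Finset.prod_le_prod (fun w _ => pow_nonneg (apply_nonneg _ _) _) fun w _ =>
          pow_le_pow_left₀ (apply_nonneg _ _) (h3 w) _
    _ = (∏ v, t v ^ v.mult) ^ finrank k K * ∏ j, ∏ w : InfinitePlace K,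
          Real.sqrt (∑ i, w (C j i) ^ 2 + ∑ i, w (D j i) ^ 2) ^ w.mult := by
        simp_rw [mul_pow, Finset.prod_mul_distrib, ← Finset.prod_pow]
        rw [Finset.prod_comm, Finset.prod_pow, prod_comap_pow_mult]
    _ ≤ (∏ v, t v ^ v.mult) ^ finrank k K * ∏ j, (H j * Ideal.absNorm (𝔟 j)) := by
        refine mul_le_mul_of_nonneg_left (Finset.prod_le_prod (fun j _ => ?_) fun j _ => hH j) ?_
        · exact Finset.prod_nonneg fun w _ => pow_nonneg (Real.sqrt_nonneg _) _
        · exact pow_nonneg (Finset.prod_nonneg fun v _ => pow_nonneg (ht v).le _) _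
    _ = _ := by rw [Finset.prod_mul_distrib, mul_assoc]

theorem fieldConst_pos (k : Type*) [Field k] [NumberField k] : 0 < fieldConst k := by
  have : (0 : ℝ) < |(discr k : ℝ)| := abs_pos.mpr (by exact_mod_cast discr_ne_zero k)
  unfold fieldConst
  positivity

theorem fieldConst_pow (k : Type*) [Field k] [NumberField k] :
    fieldConst k ^ finrank ℚ k =
      (2 / Real.pi) ^ nrComplexPlaces k * Real.sqrt |(discr k : ℝ)| := by
  unfold fieldConst
  rw [one_div, Real.rpow_inv_natCast_pow (by positivity) finrank_pos.ne']

open scoped Classical in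
/-- **Siegel's lemma**, strict form. -/
theorem exists_integral_vector_lt {k I J : Type*} [Field k]
    [NumberField k] [Fintype I] [Fintype J] (B : Matrix J I k)
    (t : InfinitePlace k → ℝ) (ht : ∀ v, 0 < t v)
    (ρ : NNReal) {S : Set (J → mixedSpace k)} (hS : MeasurableSet S)
    (hsub : ∀ u : I → mixedSpace k, (∀ i, u i ∈ convexBodyLT k fun _ => ρ) →
      ∀ w : J → mixedSpace k, (∀ j, w j ∈ convexBodyLT k fun _ => ρ) →
        (B.map (mixedEmbedding k)).mulVec u + w ∈ S)
    (hvol : volume S = ENNReal.ofReal (∏ v, t v ^ v.mult)⁻¹ *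
          volume (convexBodyLT k fun _ => NNReal.sqrt (Fintype.card I + Fintype.card J) * ρ) ^
            Fintype.card J)
    (hρ : 0 < ρ)
    (h : Nat.card (LinearMap.range (residueMap B)) *
        Real.sqrt (Fintype.card I + Fintype.card J) ^ (finrank ℚ k * Fintype.card J) *
        fieldConst k ^ (finrank ℚ k * Fintype.card I) <
      (∏ v, t v ^ v.mult) * (2 * ρ) ^ (finrank ℚ k * Fintype.card I)) :
    ∃ (u : I → 𝓞 k) (z : J → 𝓞 k), u ≠ 0 ∧ (B.mulVec fun i => (u i : k)) = (fun j => (z j : k)) ∧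
      (∀ (v : InfinitePlace k) i, v (u i) < 2 * ρ) ∧ ∀ (v : InfinitePlace k) j, v (z j) < 2 * ρ := by
  refine exists_integral_vector_of_volume_lt (C := LinearMap.range (residueMap B)) B ρ hS hsub
    (fun u => ⟨residueMap B u, u, rfl⟩) ?_ ?_
  · intro u u' huu
    obtain ⟨z, hz⟩ := (residueMap_eq_iff B u u').mp (congrArg Subtype.val huu)
    exact fun j => ⟨z j, hz j⟩
  · have hbox : ∀ r : NNReal, volume (convexBodyLT k fun _ => r) =
        ENNReal.ofReal (convexBodyLTFactor k * r ^ finrank ℚ k) := by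
      intro r
      rw [convexBodyLT_volume, Finset.prod_pow_eq_pow_sum, sum_mult_eq,
        ENNReal.ofReal_mul (NNReal.coe_nonneg _), ENNReal.ofReal_coe_nnreal,
        ← NNReal.coe_pow, ENNReal.ofReal_coe_nnreal]
    have hcov : volume (ZSpan.fundamentalDomain (latticeBasis k)) =
        ENNReal.ofReal (2⁻¹ ^ nrComplexPlaces k * Real.sqrt |(discr k : ℝ)|) := by
      rw [volume_fundamentalDomain_latticeBasis, ENNReal.ofReal_mul (by positivity),
        ENNReal.ofReal_pow (by positivity), ENNReal.ofReal_inv_of_pos two_pos, ENNReal.ofReal_ofNat]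
      congr 1
      rw [← ENNReal.ofReal_coe_nnreal, Real.coe_sqrt, coe_nnnorm, Int.norm_eq_abs]
    have hτ : 0 < ∏ v, t v ^ v.mult := Finset.prod_pos fun v _ => pow_pos (ht v) _
    have hfac : (0 : ℝ) < convexBodyLTFactor k := by
      exact_mod_cast pos_iff_ne_zero.mpr (convexBodyLTFactor_ne_zero (K := k))
    have hρ' : (0 : ℝ) < ρ := hρ
    rw [hvol, hbox, hbox, hcov, ← ENNReal.ofReal_natCast (Nat.card (LinearMap.range (residueMap B))),
      ← ENNReal.ofReal_pow (by positivity), ← ENNReal.ofReal_pow (by positivity),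
      ← ENNReal.ofReal_pow (by positivity), ← ENNReal.ofReal_pow (by positivity),
      ← ENNReal.ofReal_mul (by positivity), ← ENNReal.ofReal_mul (by positivity),
      ← ENNReal.ofReal_mul (by positivity), ← ENNReal.ofReal_mul (by positivity),
      ENNReal.ofReal_lt_ofReal_iff (by positivity)]
    set τ := ∏ v, t v ^ v.mult
    set q : ℝ := ((Nat.card (LinearMap.range (residueMap B)) : ℕ) : ℝ)
    set d := finrank ℚ k with hd
    set m := Fintype.card I
    set r := Fintype.card J
    -- The origin of `c_k`: with `d = r₁ + 2s` and box factor `2^r₁ π^s`, the covolume is `c_k^d`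
    -- times the box factor times `2^(-d)`. The box factor cancels, and `2^(-d)` turns `ρ` into
    -- `2ρ`.
    have hcf : 2⁻¹ ^ nrComplexPlaces k * Real.sqrt |(discr k : ℝ)| =
        fieldConst k ^ d * convexBodyLTFactor k * (2 ^ d)⁻¹ := by
      rw [fieldConst_pow, hd, ← card_add_two_mul_card_eq_rank, pow_add, pow_mul, div_pow, inv_pow]
      push_cast
      rw [show ((NNReal.pi : NNReal) : ℝ) = Real.pi from rfl]
      field_simp
      rw [← pow_mul, ← pow_mul]
      ring
    have hsq : ((NNReal.sqrt (m + r) * ρ : NNReal) : ℝ) = Real.sqrt (m + r) * ρ := by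
      push_cast
      rfl
    rw [hcf, hsq]
    have hpos : 0 < (convexBodyLTFactor k : ℝ) ^ m * (2 ^ (d * m))⁻¹ * τ⁻¹ *
        (convexBodyLTFactor k) ^ r * (ρ : ℝ) ^ (d * r) := by positivity
    calc q * (fieldConst k ^ d * convexBodyLTFactor k * (2 ^ d)⁻¹) ^ m *
          (τ⁻¹ * (convexBodyLTFactor k * (Real.sqrt (m + r) * ρ) ^ d) ^ r)
        = q * Real.sqrt (m + r) ^ (d * r) * fieldConst k ^ (d * m) *
          ((convexBodyLTFactor k : ℝ) ^ m * (2 ^ (d * m))⁻¹ * τ⁻¹ *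
            (convexBodyLTFactor k) ^ r * (ρ : ℝ) ^ (d * r)) := by
          simp only [mul_pow, inv_pow, ← pow_mul]
          ring
      _ < τ * (2 * ρ) ^ (d * m) * ((convexBodyLTFactor k : ℝ) ^ m * (2 ^ (d * m))⁻¹ * τ⁻¹ *
            (convexBodyLTFactor k) ^ r * (ρ : ℝ) ^ (d * r)) :=
          mul_lt_mul_of_pos_right h hpos
      _ = (convexBodyLTFactor k * (ρ : ℝ) ^ d) ^ m * (convexBodyLTFactor k * (ρ : ℝ) ^ d) ^ r := by
          simp only [mul_pow, ← pow_mul]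
          field_simp

/-- **Siegel's lemma** over `k`, for a system of linear equations over an extension `K`: a matrix
`(C | D)` with `D = C B` and with rows in the ideals `𝔟 j`. -/
theorem exists_integral_vector_le {k K I J : Type*} [Field k] [NumberField k] [Field K]
    [NumberField K] [Algebra k K] [Fintype I] [Fintype J] [DecidableEq J] (B : Matrix J I k)
    (C : Matrix J J (𝓞 K)) (hC : C.det ≠ 0) (D : Matrix J I (𝓞 K)) (𝔟 : J → Ideal (𝓞 K))
    (hCD : D.map (algebraMap (𝓞 K) K) = C.map (algebraMap (𝓞 K) K) * B.map (algebraMap k K))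
    (hCb : ∀ j i, C j i ∈ 𝔟 j) (hDb : ∀ j i, D j i ∈ 𝔟 j) (H : J → ℝ)
    (hH : ∀ j, ∏ w : InfinitePlace K,
      Real.sqrt (∑ i, w (C j i) ^ 2 + ∑ i, w (D j i) ^ 2) ^ w.mult ≤ H j * Ideal.absNorm (𝔟 j))
    (hI : 0 < Fintype.card I) {R : ℝ} (hR : 0 < R)
    (h : Real.sqrt (Fintype.card I + Fintype.card J) ^
        (finrank ℚ k * Fintype.card J * finrank k K) *
        fieldConst k ^ (finrank ℚ k * Fintype.card I * finrank k K) * ∏ j, H j ≤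
      R ^ (finrank ℚ k * Fintype.card I * finrank k K)) :
    ∃ (u : I → 𝓞 k) (z : J → 𝓞 k), u ≠ 0 ∧ (B.mulVec fun i => (u i : k)) = (fun j => (z j : k)) ∧
      (∀ (v : InfinitePlace k) i, v (u i) ≤ R) ∧ ∀ (v : InfinitePlace k) j, v (z j) ≤ R := by
  obtain ⟨t, ht, htC, hS⟩ := exists_shear_bound B
  have hq := natCard_range_residueMap_pow_le B C hC D 𝔟 hCD hCb hDb H hH t ht
    (fun σ C => by convert htC σ C)
  set q : ℝ := ((Nat.card (LinearMap.range (residueMap B)) : ℕ) : ℝ)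
  set τ := ∏ v, t v ^ v.mult
  have hτ : 0 < τ := Finset.prod_pos fun v _ => pow_pos (ht v) _
  have he : finrank k K ≠ 0 := finrank_pos.ne'
  have hc := fieldConst_pos k
  -- Blichfeldt's principle needs a strict inequality, so `R` is first enlarged to `R' = 2ρ`. The
  -- volume condition is checked after raising to the power `[K:k]`, where `hq` applies and `τ`
  -- cancels.
  have key : ∀ R' : ℝ, R < R' → ∃ (u : I → 𝓞 k) (z : J → 𝓞 k), u ≠ 0 ∧
      (B.mulVec fun i => (u i : k)) = (fun j => (z j : k)) ∧
      (∀ (v : InfinitePlace k) i, v (u i) < R') ∧ ∀ (v : InfinitePlace k) j, v (z j) < R' := by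
    intro R' hR'
    have hR'0 : 0 < R' := hR.trans hR'
    obtain ⟨ρ, e2⟩ : ∃ ρ : NNReal, 2 * (ρ : ℝ) = R' :=
      ⟨Real.toNNReal (R' / 2), by rw [Real.coe_toNNReal _ (by positivity)]; ring⟩
    obtain ⟨S, hSm, hsub, hvol⟩ := hS ρ
    have := exists_integral_vector_lt B t ht ρ hSm
      (by convert hsub) (by convert hvol) (by rw [← NNReal.coe_pos]; linarith) ?_
    · rw [e2] at this
      exact this
    · rw [e2]
      refine lt_of_pow_lt_pow_left₀ (finrank k K) (by positivity) ?_
      have hx : 0 ≤ (Real.sqrt (Fintype.card I + Fintype.card J) ^ (finrank ℚ k * Fintype.card J) *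
        fieldConst k ^ (finrank ℚ k * Fintype.card I)) ^ finrank k K := by positivity
      calc (q * Real.sqrt (Fintype.card I + Fintype.card J) ^ (finrank ℚ k * Fintype.card J) *
              fieldConst k ^ (finrank ℚ k * Fintype.card I)) ^ finrank k K
          = q ^ finrank k K * (Real.sqrt (Fintype.card I + Fintype.card J) ^
              (finrank ℚ k * Fintype.card J) *
              fieldConst k ^ (finrank ℚ k * Fintype.card I)) ^ finrank k K := by
            rw [mul_assoc, mul_pow]
        _ ≤ (τ ^ finrank k K * ∏ j, H j) * (Real.sqrt (Fintype.card I + Fintype.card J) ^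
              (finrank ℚ k * Fintype.card J) *
              fieldConst k ^ (finrank ℚ k * Fintype.card I)) ^ finrank k K :=
            mul_le_mul_of_nonneg_right hq hx
        _ = τ ^ finrank k K * (Real.sqrt (Fintype.card I + Fintype.card J) ^
              (finrank ℚ k * Fintype.card J * finrank k K) *
              fieldConst k ^ (finrank ℚ k * Fintype.card I * finrank k K) * ∏ j, H j) := by
            rw [mul_pow, ← pow_mul, ← pow_mul]
            ring
        _ ≤ τ ^ finrank k K * R ^ (finrank ℚ k * Fintype.card I * finrank k K) :=
            mul_le_mul_of_nonneg_left h (by positivity)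
        _ < τ ^ finrank k K * R' ^ (finrank ℚ k * Fintype.card I * finrank k K) := by
            refine mul_lt_mul_of_pos_left (pow_lt_pow_left₀ hR' hR.le ?_) (by positivity)
            exact mul_ne_zero (mul_ne_zero finrank_pos.ne' hI.ne') he
        _ = (τ * R' ^ (finrank ℚ k * Fintype.card I)) ^ finrank k K := by
            rw [mul_pow, ← pow_mul]
  -- Only finitely many integral vectors are bounded by `R + 1`, so one pair serves infinitely many
  -- of the radii `R + 1/(n+1)` and therefore satisfies the bound `R` itself.
  have hfin : {p : (I → 𝓞 k) × (J → 𝓞 k) | (∀ i, p.1 i ∈ {x : 𝓞 k | ∀ v : InfinitePlace k, v x ≤ R + 1}) ∧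
      ∀ j, p.2 j ∈ {x : 𝓞 k | ∀ v : InfinitePlace k, v x ≤ R + 1}}.Finite := by
    have h1 := Set.Finite.pi' (ι := I) fun _ => finite_setOf_forall_infinitePlace_le k (R + 1)
    have h2 := Set.Finite.pi' (ι := J) fun _ => finite_setOf_forall_infinitePlace_le k (R + 1)
    exact h1.prod h2
  have key' := fun n : ℕ => key (R + 1 / ((n : ℝ) + 1)) (by
    have : (0 : ℝ) < 1 / ((n : ℝ) + 1) := by positivity
    linarith)
  choose u z hu0 huz hub hzb using key'
  have hle1 : ∀ n : ℕ, R + 1 / ((n : ℝ) + 1) ≤ R + 1 := fun n => by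
    have : 1 / ((n : ℝ) + 1) ≤ 1 := by
      rw [div_le_one (by positivity)]
      linarith [(Nat.cast_nonneg n : (0 : ℝ) ≤ n)]
    linarith
  have := hfin.to_subtype
  obtain ⟨p, hp⟩ := Finite.exists_infinite_fiber (fun n : ℕ =>
    (⟨(u n, z n), fun i v => (hub n v i).le.trans (hle1 n),
      fun j v => (hzb n v j).le.trans (hle1 n)⟩ : {p : (I → 𝓞 k) × (J → 𝓞 k) |
        (∀ i, p.1 i ∈ {x : 𝓞 k | ∀ v : InfinitePlace k, v x ≤ R + 1}) ∧
          ∀ j, p.2 j ∈ {x : 𝓞 k | ∀ v : InfinitePlace k, v x ≤ R + 1}}))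
  have hp' := Set.infinite_coe_iff.mp hp
  have hlim : ∀ a : ℝ, (∀ n : ℕ, u n = p.1.1 → z n = p.1.2 → a < R + 1 / ((n : ℝ) + 1)) → a ≤ R := by
    intro a ha
    by_contra! hlt
    obtain ⟨m, hm⟩ := exists_nat_one_div_lt (sub_pos.mpr hlt)
    obtain ⟨n, hn, hmn⟩ := hp'.exists_gt m
    have hn' : (u n, z n) = p.1 := congrArg Subtype.val hn
    have h1 := ha n (congrArg Prod.fst hn') (congrArg Prod.snd hn')
    have h2 : 1 / ((n : ℝ) + 1) ≤ 1 / ((m : ℝ) + 1) := by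
      have : (m : ℝ) < n := by exact_mod_cast hmn
      gcongr
    linarith
  obtain ⟨n, hn⟩ := hp'.nonempty
  have hn' : (u n, z n) = p.1 := congrArg Subtype.val hn
  refine ⟨p.1.1, p.1.2, ?_, ?_, fun v i => hlim _ fun n h1 _ => ?_, fun v j => hlim _ fun n _ h2 => ?_⟩
  · rw [← congrArg Prod.fst hn']; exact hu0 n
  · rw [← congrArg Prod.fst hn', ← congrArg Prod.snd hn']; exact huz n
  · rw [← h1]; exact hub n v i
  · rw [← h2]; exact hzb n v j

end Siegel

/-! ### Pivot coordinates and Galois descent -/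

section Descent

open Module

/-- Every subspace of `k ^ ι` is a graph over suitable coordinates. -/
theorem exists_pivots {k ι : Type*} [Field k] [Fintype ι] [DecidableEq ι]
    (V : Submodule k (ι → k)) :
    ∃ (J : Finset ι) (B : Matrix {i // i ∈ J} {i // i ∉ J} k),
      (∀ x ∈ V, (∀ i ∉ J, x i = 0) → x = 0) ∧
      (∀ u : {i // i ∉ J} → k, (fun i => if h : i ∈ J then -(B.mulVec u ⟨i, h⟩) else u ⟨i, h⟩) ∈ V) ∧
      Fintype.card {i // i ∉ J} = finrank k V := by
  -- `J` is maximal among the sets supporting no nonzero vector of `V`. Adjoining any `i ∉ J` then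
  -- yields a vector of `V` supported on `J ∪ {i}` and nonzero at `i`; rescaled, these are the `y
  -- i`, and `B` records their negated `J`-coordinates.
  obtain ⟨J, hJ⟩ := (Set.toFinite {J : Finset ι | ∀ x ∈ V, (∀ i ∉ J, x i = 0) → x = 0}).exists_maximal
    ⟨∅, fun x _ h => funext fun i => h i (Finset.notMem_empty i)⟩
  have hy : ∀ i : {i // i ∉ J}, ∃ y ∈ V, y i = 1 ∧ ∀ i' : {i // i ∉ J}, i' ≠ i → y i' = 0 := by
    intro i
    have hnot : ¬ ∀ x ∈ V, (∀ i' ∉ insert i.1 J, x i' = 0) → x = 0 := fun h =>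
      i.2 (hJ.2 h (Finset.subset_insert i.1 J) (Finset.mem_insert_self _ _))
    push Not at hnot
    obtain ⟨x, hxV, hx, hx0⟩ := hnot
    have hxi : x i ≠ 0 := by
      intro h0
      refine hx0 (hJ.1 x hxV fun i' hi' => ?_)
      by_cases h : i' = i.1
      · rw [h]; exact h0
      · exact hx i' (by simp [h, hi'])
    refine ⟨(x i)⁻¹ • x, V.smul_mem _ hxV, by simp [hxi], fun i' hi' => ?_⟩
    have : x i' = 0 := hx i' (by
      rw [Finset.mem_insert, not_or]
      exact ⟨fun h => hi' (Subtype.ext h), i'.2⟩)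
    simp [this]
  choose y hyV hy1 hy0 using hy
  refine ⟨J, Matrix.of fun j i => -y i j, hJ.1, ?_, ?_⟩
  · intro u
    have : (fun i => if h : i ∈ J then
        -((Matrix.of fun (j : {i // i ∈ J}) i => -y i j).mulVec u ⟨i, h⟩) else u ⟨i, h⟩) =
        ∑ i, u i • y i := by
      ext i
      rw [Finset.sum_apply]
      by_cases h : i ∈ J
      · simp [h, Matrix.mulVec, dotProduct, mul_comm]
      · rw [dif_neg h, Finset.sum_eq_single ⟨i, h⟩]
        · simp [hy1 ⟨i, h⟩]
        · intro i' _ hi'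
          simp [hy0 i' ⟨i, h⟩ hi'.symm]
        · simp
    rw [this]
    exact V.sum_mem fun i _ => V.smul_mem _ (hyV i)
  · let f : V →ₗ[k] ({i // i ∉ J} → k) := (LinearMap.funLeft k k Subtype.val) ∘ₗ V.subtype
    have hinj : Function.Injective f := by
      rw [injective_iff_map_eq_zero]
      intro x hx
      exact Subtype.ext (hJ.1 x x.2 fun i hi => congrFun hx ⟨i, hi⟩)
    have hsurj : Function.Surjective f := by
      intro u
      refine ⟨∑ i, u i • ⟨y i, hyV i⟩, ?_⟩
      ext i
      rw [map_sum, Finset.sum_apply, Finset.sum_eq_single i]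
      · simp [f, LinearMap.funLeft_apply, hy1]
      · intro i' _ hi'
        simp [f, LinearMap.funLeft_apply, hy0 i' i hi'.symm]
      · simp
    rw [(LinearEquiv.ofBijective f ⟨hinj, hsurj⟩).finrank_eq, finrank_fintype_fun_eq_card]

/-- If no nonzero vector is killed by all the forms, they span the dual space, so a basis can be
chosen among them. -/
theorem exists_det_ne_zero_of_forall_eq_zero {K J Λ : Type*} [Field K] [Fintype J] [DecidableEq J]
    (a : Λ → J → K) (h : ∀ c : J → K, (∀ l, ∑ j, a l j * c j = 0) → c = 0) :
    ∃ l : J → Λ, (Matrix.of fun j => a (l j)).det ≠ 0 := by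
  have hspan : Submodule.span K (Set.range a) = ⊤ := by
    by_contra hne
    obtain ⟨f, hf0, hf⟩ := Submodule.exists_le_ker_of_lt_top _ (lt_top_iff_ne_top.mpr hne)
    apply hf0
    have hfc : ∀ x, f x = ∑ j, x j * f (Pi.single j 1) := by
      intro x
      conv_lhs => rw [← Finset.univ_sum_single x, map_sum]
      refine Finset.sum_congr rfl fun j _ => ?_
      rw [← smul_eq_mul, ← map_smul, ← Pi.single_smul, smul_eq_mul, mul_one]
    have h0 := h (fun j => f (Pi.single j 1)) fun l => by
      rw [← hfc]
      exact hf (Submodule.subset_span ⟨l, rfl⟩)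
    ext x
    simp [congrFun h0 x]
  obtain ⟨κ, b, -, hb, hli⟩ := exists_linearIndependent' K a
  have hfin : Finite κ := hli.finite
  have := Fintype.ofFinite κ
  have hcard : Fintype.card J = Fintype.card κ := by
    rw [← finrank_fintype_fun_eq_card K (η := J),
      finrank_eq_card_basis (Basis.mk hli (by rw [hb, hspan]))]
  let e := Fintype.equivOfCardEq hcard
  refine ⟨b ∘ e, ?_⟩
  have hli' : LinearIndependent K (a ∘ b ∘ e) := hli.comp e e.injective
  have := Matrix.linearIndependent_rows_iff_isUnit.mp
    (show LinearIndependent K (Matrix.of fun j => a ((b ∘ e) j)).row from hli')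
  exact ((Matrix.isUnit_iff_isUnit_det _).mp this).ne_zero

/-- Galois descent: if a subspace `V` of `k ^ ι` is cut out by a Galois stable family of linear forms
over `K`, and no nonzero element of `V` is supported on `J`, then the forms separate the vectors of
`K ^ ι` supported on `J`. -/
theorem eq_zero_of_supported_of_forall {k K ι Λ : Type*} [Field k] [Field K] [Algebra k K]
    [FiniteDimensional k K] [IsGalois k K] [Fintype ι] [DecidableEq ι] {V : Submodule k (ι → k)}
    (a : Λ → ι → K) (hV : ∀ x : ι → k, (∀ l, ∑ i, a l i * algebraMap k K (x i) = 0) → x ∈ V)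
    (ha : ∀ (σ : K ≃ₐ[k] K) l, ∃ l', ∀ i, a l' i = σ (a l i)) (J : Finset ι)
    (hJ : ∀ x ∈ V, (∀ i ∉ J, x i = 0) → x = 0) (c : {i // i ∈ J} → K)
    (hc : ∀ l, ∑ j : {i // i ∈ J}, a l j * c j = 0) : c = 0 := by
  set c' : ι → K := fun i => if h : i ∈ J then c ⟨i, h⟩ else 0 with hc'
  have hsum : ∀ l, ∑ i, a l i * c' i = 0 := by
    intro l
    rw [← hc l, ← Finset.sum_subset (Finset.subset_univ J), ← Finset.sum_coe_sort]
    · exact Finset.sum_congr rfl fun j _ => by simp [hc']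
    · intro i _ hi
      simp [hc', hi]
  -- By stability of the family under conjugation, the coordinatewise trace of `θ c'` satisfies all
  -- equations. It is supported on `J` and so vanishes; as `θ` varies, nondegeneracy of the trace
  -- form gives `c = 0`.
  have ht : ∀ θ : K, (fun i => Algebra.trace k K (θ * c' i)) = 0 := by
    intro θ
    refine hJ _ (hV _ fun l => ?_) fun i hi => by simp [hc', hi]
    simp_rw [trace_eq_sum_automorphisms, map_mul, Finset.mul_sum]
    rw [Finset.sum_comm]
    refine Finset.sum_eq_zero fun σ _ => ?_
    obtain ⟨l', hl'⟩ := ha σ.symm l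
    have h1 := congrArg σ (hsum l')
    rw [map_sum, map_zero] at h1
    calc ∑ i, a l i * (σ θ * σ (c' i)) = σ θ * ∑ i, σ (a l' i * c' i) := by
          rw [Finset.mul_sum]
          refine Finset.sum_congr rfl fun i _ => ?_
          rw [map_mul, hl', AlgEquiv.apply_symm_apply]
          ring
      _ = 0 := by rw [h1, mul_zero]
  ext j
  have hj : ∀ θ : K, Algebra.traceForm k K (c j) θ = 0 := by
    intro θ
    have := congrFun (ht θ) j
    simpa [hc', Algebra.traceForm_apply, mul_comm] using this
  exact (traceForm_nondegenerate k K).1 _ hj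

end Descent

/-! ### Siegel's lemma for a subspace defined over an extension -/

section SiegelSubspace

open Module NumberField NumberField.InfinitePlace

theorem sum_mem_add_sum_notMem {ι M : Type*} [Fintype ι] [AddCommMonoid M] (J : Finset ι)
    [Fintype {i // i ∉ J}] (f : ι → M) :
    ∑ i : {i // i ∈ J}, f i + ∑ i : {i // i ∉ J}, f i = ∑ i, f i := by
  classical
  convert Fintype.sum_subtype_add_sum_subtype (fun i => i ∈ J) f

/-- Siegel's lemma for a subspace `V` of `k ^ ι` cut out by a Galois stable family of linear forms
with integral coefficients in an extension `K`. -/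
theorem exists_integral_vector_mem_le {k K ι Λ : Type*} [Field k] [NumberField k] [Field K]
    [NumberField K] [Algebra k K] [IsGalois k K] [Fintype ι] {V : Submodule k (ι → k)}
    (a : Λ → ι → 𝓞 K)
    (hV : ∀ x : ι → k, x ∈ V ↔ ∀ l, ∑ i, (a l i : K) * algebraMap k K (x i) = 0)
    (ha : ∀ (σ : K ≃ₐ[k] K) l, ∃ l', ∀ i, (a l' i : K) = σ (a l i))
    (𝔟 : Λ → Ideal (𝓞 K)) (hab : ∀ l i, a l i ∈ 𝔟 l) (H : ℝ)
    (hH : ∀ l, ∏ w : InfinitePlace K, Real.sqrt (∑ i, w (a l i) ^ 2) ^ w.mult ≤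
      H * Ideal.absNorm (𝔟 l))
    (hV0 : 0 < finrank k V) {r : ℕ} (hr : r + finrank k V = Fintype.card ι) {R : ℝ} (hR : 0 < R)
    (h : Nonempty Λ ∨ r = 0 → Real.sqrt (Fintype.card ι) ^ (finrank ℚ k * r * finrank k K) *
        fieldConst k ^ (finrank ℚ k * finrank k V * finrank k K) * H ^ r ≤
      R ^ (finrank ℚ k * finrank k V * finrank k K)) :
    ∃ x : ι → 𝓞 k, x ≠ 0 ∧ (fun i => (x i : k)) ∈ V ∧ ∀ (v : InfinitePlace k) i, v (x i) ≤ R := by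
  classical
  obtain ⟨J, B, hJ, hB, hcard⟩ := exists_pivots V
  have hcardJ : Fintype.card {i // i ∈ J} = r := by
    have := Fintype.card_subtype_compl (fun i => i ∈ J)
    have h2 := Fintype.card_subtype_le (fun i => i ∈ J)
    omega
  obtain ⟨l, hl⟩ := exists_det_ne_zero_of_forall_eq_zero
    (fun (l : Λ) (j : {i // i ∈ J}) => (a l j : K)) fun c hc =>
      eq_zero_of_supported_of_forall (fun l i => (a l i : K)) (fun x hx => (hV x).mpr hx) ha J hJ c hc
  set C : Matrix {i // i ∈ J} {i // i ∈ J} (𝓞 K) := Matrix.of fun j i => a (l j) i with hC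
  set D : Matrix {i // i ∈ J} {i // i ∉ J} (𝓞 K) := Matrix.of fun j i => a (l j) i with hD
  have hCdet : C.det ≠ 0 := by
    intro h0
    apply hl
    have : (Matrix.of fun j (i : {i // i ∈ J}) => (a (l j) i : K)) =
        (algebraMap (𝓞 K) K).mapMatrix C := rfl
    rw [this, ← RingHom.map_det, h0, map_zero]
  -- Evaluating the selected forms on the vector `(-B e_i, e_i)` of `V` gives `-C B e_i + D e_i =
  -- 0`.
  have hCD : D.map (algebraMap (𝓞 K) K) =
      C.map (algebraMap (𝓞 K) K) * B.map (algebraMap k K) := by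
    ext j i
    have h1 := (hV _).mp (hB (Pi.single i 1)) (l j)
    rw [← sum_mem_add_sum_notMem J] at h1
    have h2 : ∑ i' : {i // i ∈ J}, (a (l j) i' : K) * algebraMap k K (if h : i'.1 ∈ J then
        -(B.mulVec (Pi.single i 1) ⟨i', h⟩) else (Pi.single i 1 : {i // i ∉ J} → k) ⟨i', h⟩) =
        - ∑ i' : {i // i ∈ J}, (a (l j) i' : K) * algebraMap k K (B i' i) := by
      rw [← Finset.sum_neg_distrib]
      refine Finset.sum_congr rfl fun i' _ => ?_
      rw [dif_pos i'.2]
      simp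
    have h3 : ∑ i' : {i // i ∉ J}, (a (l j) i' : K) * algebraMap k K (if h : i'.1 ∈ J then
        -(B.mulVec (Pi.single i 1) ⟨i', h⟩) else (Pi.single i 1 : {i // i ∉ J} → k) ⟨i', h⟩) =
        (a (l j) i : K) := by
      rw [Finset.sum_eq_single i]
      · rw [dif_neg i.2]
        simp
      · intro i' _ hi'
        rw [dif_neg i'.2]
        simp [Pi.single_eq_of_ne hi']
      · simp
    rw [h2, h3, neg_add_eq_zero] at h1
    exact h1.symm
  have hΛ : Nonempty Λ ∨ r = 0 := by
    rcases Nat.eq_zero_or_pos r with h0 | h0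
    · exact Or.inr h0
    · rw [← hcardJ] at h0
      exact Or.inl ((Fintype.card_pos_iff.mp h0).map l)
  obtain ⟨u, z, hu0, huz, hub, hzb⟩ := exists_integral_vector_le B C hCdet D (fun j => 𝔟 (l j)) hCD
    (fun j i => hab _ _) (fun j i => hab _ _) (fun _ => H)
    (fun j => by
      convert hH (l j) using 5 with w
      exact sum_mem_add_sum_notMem J fun i => w (a (l j) i : K) ^ 2)
    (hcard ▸ hV0) hR (by
      rw [Finset.prod_const, Finset.card_univ, hcard, hcardJ, ← Nat.cast_add, add_comm, hr]
      exact h hΛ)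
  refine ⟨fun i => if h : i ∈ J then -z ⟨i, h⟩ else u ⟨i, h⟩, ?_, ?_, ?_⟩
  · intro h0
    apply hu0
    ext i
    have := congrFun h0 i.1
    rw [dif_neg i.2] at this
    simp [this]
  · convert hB (fun i => (u i : k)) using 2 with i
    by_cases hi : i ∈ J
    · simp only [dif_pos hi, huz]
      simp
    · simp only [dif_neg hi]
  · intro v i
    by_cases hi : i ∈ J
    · simp only [dif_pos hi]
      have h1 : ((-z ⟨i, hi⟩ : 𝓞 k) : k) = -(z ⟨i, hi⟩ : k) := map_neg (algebraMap (𝓞 k) k) _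
      rw [h1]
      exact (v.1.map_neg _).trans_le (hzb v _)
    · simp only [dif_neg hi]
      exact hub v _

end SiegelSubspace

/-! ### Heights of integral vectors -/

section Heights

open Module NumberField NumberField.InfinitePlace

/-- The archimedean part of the height of an integral vector, in an extension field. -/
theorem prod_iSup_pow_mult_algebraMap {F K ι : Type*} [Field F] [NumberField F] [Field K]
    [NumberField K] [Algebra F K] [Finite ι] {y : ι → 𝓞 F} (hy : y ≠ 0) :
    ∏ w : InfinitePlace K, (⨆ i, w (algebraMap (𝓞 F) (𝓞 K) (y i) : K)) ^ w.mult =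
      Height.mulHeight (fun i => (y i : F)) ^ finrank F K *
        Ideal.absNorm (Ideal.span (Set.range fun i => algebraMap (𝓞 F) (𝓞 K) (y i))) := by
  have h1 : ∏ w : InfinitePlace K, (⨆ i, w (algebraMap (𝓞 F) (𝓞 K) (y i) : K)) ^ w.mult =
      (∏ v : InfinitePlace F, (⨆ i, v (y i : F)) ^ v.mult) ^ finrank F K := by
    rw [← prod_comap_pow_mult (K := K) fun v => ⨆ i, v (y i : F)]
    rfl
  have h2 : Ideal.span (Set.range fun i => algebraMap (𝓞 F) (𝓞 K) (y i)) =
      (Ideal.span (Set.range y)).map (algebraMap (𝓞 F) (𝓞 K)) := by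
    rw [Ideal.map_span, ← Set.range_comp]
    rfl
  have h3 := absNorm_mul_finprod_finitePlace_eq_one hy
  have hy' : (fun i => (y i : F)) ≠ 0 := by
    obtain ⟨i, hi⟩ := Function.ne_iff.mp hy
    exact Function.ne_iff.mpr ⟨i, by simpa using hi⟩
  rw [h1, h2, Ideal.absNorm_algebraMap, IsFractionRing.finrank_eq (𝓞 F) F (𝓞 K) K,
    mulHeight_eq hy', Nat.cast_pow, ← mul_pow]
  congr 1
  rw [mul_assoc, mul_comm (finprod _), h3, mul_one]

/-- For integral coordinates the finite part of the height is the inverse norm of the ideal they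
generate, hence at most 1; only the infinite places matter. -/
theorem absLogHeight_le_log {k ι : Type*} [Field k] [NumberField k] [Finite ι] {x : ι → 𝓞 k}
    (hx : x ≠ 0) {R : ℝ} (hR : ∀ (v : InfinitePlace k) i, v (x i) ≤ R) :
    absLogHeight k (fun i => (x i : k)) ≤ Real.log R := by
  obtain ⟨i₀, hi₀⟩ := Function.ne_iff.mp hx
  have : Nonempty ι := ⟨i₀⟩
  have hx' : (fun i => (x i : k)) ≠ 0 := Function.ne_iff.mpr ⟨i₀, by simpa using hi₀⟩
  have hd : (0 : ℝ) < finrank ℚ k := by exact_mod_cast finrank_pos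
  rw [absLogHeight, div_le_iff₀' hd, Height.logHeight_eq_log_mulHeight, ← Real.log_pow]
  refine Real.log_le_log (Height.mulHeight_pos _) ?_
  have h3 := absNorm_mul_finprod_finitePlace_eq_one hx
  have hnorm : (1 : ℝ) ≤ Ideal.absNorm (Ideal.span (Set.range x)) := by
    rw [Nat.one_le_cast, Nat.one_le_iff_ne_zero]
    intro h0
    rw [h0] at h3
    simp at h3
  have hpos : 0 ≤ ∏ v : InfinitePlace k, (⨆ i, v (x i : k)) ^ v.mult :=
    Finset.prod_nonneg fun v _ => pow_nonneg (Real.iSup_nonneg fun i => apply_nonneg v _) _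
  have hfin : ∏ᶠ v : FinitePlace k, ⨆ i, v (x i : k) ≤ 1 := by
    by_contra! hlt
    nlinarith
  calc Height.mulHeight (fun i => (x i : k))
      = (∏ v : InfinitePlace k, (⨆ i, v (x i : k)) ^ v.mult) *
          ∏ᶠ v : FinitePlace k, ⨆ i, v (x i : k) := mulHeight_eq hx'
    _ ≤ (∏ v : InfinitePlace k, (⨆ i, v (x i : k)) ^ v.mult) * 1 :=
        mul_le_mul_of_nonneg_left hfin hpos
    _ ≤ ∏ v : InfinitePlace k, R ^ v.mult := by
        rw [mul_one]
        refine Finset.prod_le_prod (fun v _ => pow_nonneg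
          (Real.iSup_nonneg fun i => apply_nonneg v _) _) fun v _ => ?_
        exact pow_le_pow_left₀ (Real.iSup_nonneg fun i => apply_nonneg v _)
          (ciSup_le fun i => hR v i) _
    _ = R ^ finrank ℚ k := by rw [Finset.prod_pow_eq_pow_sum, sum_mult_eq]

end Heights

/-! ### Divided derivatives and polynomials as coefficient vectors -/

section Polynomials

open Module MvPolynomial

theorem pderiv_pow_monomial {k : Type*} [Field k] {n : ℕ} (i : Fin n) (a : ℕ) (m : Fin n →₀ ℕ)
    (c : k) :
    (((pderiv i).toLinearMap : Module.End k (MvPolynomial (Fin n) k)) ^ a) (monomial m c) =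
      monomial (m - Finsupp.single i a) (c * ((m i).descFactorial a : ℕ)) := by
  induction a with
  | zero => simp
  | succ a ih =>
    rw [pow_succ', Module.End.mul_apply, ih]
    change pderiv i _ = _
    rw [pderiv_monomial, tsub_tsub, ← Finsupp.single_add, Nat.descFactorial_succ]
    congr 1
    simp only [Finsupp.tsub_apply, Finsupp.single_eq_same]
    push_cast
    ring

theorem partialDeriv_monomial {k : Type*} [Field k] {n : ℕ} (l : Fin n → ℕ) (m : Fin n →₀ ℕ)
    (c : k) :
    partialDeriv l (monomial m c) = monomial (m - Finsupp.equivFunOnFinite.symm l)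
      (c * ((∏ i, (m i).descFactorial (l i) : ℕ) : k)) := by
  have key : ∀ s : List (Fin n), s.Nodup →
      (s.map fun i => ((pderiv i).toLinearMap : Module.End k (MvPolynomial (Fin n) k)) ^ l i).prod
        (monomial m c) = monomial (m - (s.map fun i => Finsupp.single i (l i)).sum)
          (c * (((s.map fun i => (m i).descFactorial (l i)).prod : ℕ) : k)) := by
    intro s hs
    induction s with
    | nil => simp
    | cons i s ih =>
      rw [List.nodup_cons] at hs
      rw [List.map_cons, List.prod_cons, Module.End.mul_apply, ih hs.2, pderiv_pow_monomial]
      have h0 : (s.map fun i => Finsupp.single i (l i)).sum i = 0 := by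
        have hi := hs.1
        clear ih hs
        induction s with
        | nil => simp
        | cons j s ih =>
          rw [List.mem_cons, not_or] at hi
          rw [List.map_cons, List.sum_cons, Finsupp.add_apply, ih hi.2,
            Finsupp.single_eq_of_ne hi.1]
      rw [tsub_tsub, List.map_cons, List.sum_cons, add_comm, Finsupp.tsub_apply, h0, tsub_zero,
        List.map_cons, List.prod_cons]
      congr 1
      push_cast
      ring
  rw [partialDeriv, List.ofFn_eq_map, key _ (List.nodup_finRange n)]
  have h1 : ((List.finRange n).map fun i => Finsupp.single i (l i)).sum =
      Finsupp.equivFunOnFinite.symm l := by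
    rw [← List.ofFn_eq_map, List.sum_ofFn]
    ext i
    rw [Finsupp.finsetSum_apply, Finset.sum_eq_single i]
    · simp
    · intro j _ hj
      exact Finsupp.single_eq_of_ne hj.symm
    · simp
  rw [h1, ← List.ofFn_eq_map, List.prod_ofFn]

/-- Dividing by the factorials leaves binomial coefficients, which are integral and small. The
truncated subtraction of exponents is harmless, since the binomial product vanishes as soon as some
`m i < l i`. -/
theorem dividedDeriv_monomial {k : Type*} [Field k] [CharZero k] {n : ℕ} (l : Fin n → ℕ)
    (m : Fin n →₀ ℕ) (c : k) :
    dividedDeriv l (monomial m c) = monomial (m - Finsupp.equivFunOnFinite.symm l)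
      (c * ((∏ i, (m i).choose (l i) : ℕ) : k)) := by
  rw [dividedDeriv, LinearMap.smul_apply, partialDeriv_monomial, smul_monomial, smul_eq_mul]
  congr 1
  have h : (∏ i, ((l i).factorial : k)) ≠ 0 :=
    Finset.prod_ne_zero_iff.mpr fun i _ => by exact_mod_cast (l i).factorial_ne_zero
  simp_rw [Nat.descFactorial_eq_factorial_mul_choose]
  rw [Finset.prod_mul_distrib]
  push_cast
  field_simp

theorem aeval_dividedDeriv_monomial {k A : Type*} [Field k] [CharZero k] [CommRing A] [Algebra k A]
    {n : ℕ} (l : Fin n → ℕ) (m : Fin n →₀ ℕ) (c : k) (x : Fin n → A) :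
    aeval x (dividedDeriv l (monomial m c)) =
      ((∏ i, (m i).choose (l i) : ℕ) * ∏ i, x i ^ (m i - l i)) * algebraMap k A c := by
  rw [dividedDeriv_monomial, aeval_monomial, Finsupp.prod_fintype _ _ fun i => pow_zero _, map_mul,
    map_natCast]
  simp only [Finsupp.tsub_apply, Finsupp.equivFunOnFinite_symm_apply_apply]
  ring

/-- The exponents of the monomials of total degree at most `L`. -/
abbrev Exponents (n L : ℕ) : Type := {m : Fin n →₀ ℕ // (m.sum fun _ e => e) ≤ L}

theorem exponents_sum_le {n L : ℕ} (m : Exponents n L) : ∑ i, m.1 i ≤ L := by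
  have := m.2
  rwa [Finsupp.sum_fintype _ _ fun _ => rfl] at this

theorem exponents_apply_le {n L : ℕ} (m : Exponents n L) (i : Fin n) : m.1 i ≤ L :=
  (Finset.single_le_sum (fun _ _ => Nat.zero_le _) (Finset.mem_univ i)).trans (exponents_sum_le m)

theorem exponents_box_injective (n L : ℕ) : Function.Injective
    fun (m : Exponents n L) (i : Fin n) => (⟨m.1 i, Nat.lt_succ_of_le (exponents_apply_le m i)⟩ :
      Fin (L + 1)) := fun a b h => Subtype.ext <| Finsupp.ext fun i => by
  simpa using congrFun h i

instance (n L : ℕ) : Finite (Exponents n L) := Finite.of_injective _ (exponents_box_injective n L)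

instance (n L : ℕ) : Fintype (Exponents n L) := Fintype.ofFinite _

/-- The crude box count suffices: it is the source of the summand `n log (L+1)`. -/
theorem card_exponents_le (n L : ℕ) : Fintype.card (Exponents n L) ≤ (L + 1) ^ n := by
  simpa using Fintype.card_le_of_injective _ (exponents_box_injective n L)

theorem dimPoly_eq_card (k : Type*) [Field k] (n L : ℕ) :
    dimPoly k n L = Fintype.card (Exponents n L) :=
  finrank_eq_card_basis (basisRestrictSupport k {m : Fin n →₀ ℕ | (m.sum fun _ e => e) ≤ L})

/-- The polynomial with given coefficients. -/
def polyOfCoeffs (k : Type*) [Field k] (n L : ℕ) :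
    (Exponents n L → k) →ₗ[k] MvPolynomial (Fin n) k :=
  ∑ m : Exponents n L, (monomial m.1).comp (LinearMap.proj m)

theorem polyOfCoeffs_apply {k : Type*} [Field k] {n L : ℕ} (x : Exponents n L → k) :
    polyOfCoeffs k n L x = ∑ m : Exponents n L, monomial m.1 (x m) := by
  simp [polyOfCoeffs]

theorem coeff_polyOfCoeffs {k : Type*} [Field k] {n L : ℕ} (x : Exponents n L → k)
    (m : Exponents n L) : coeff m.1 (polyOfCoeffs k n L x) = x m := by
  classical
  rw [polyOfCoeffs_apply, coeff_sum, Finset.sum_eq_single m]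
  · simp
  · intro m' _ hm'
    rw [coeff_monomial, if_neg fun h => hm' (Subtype.ext h)]
  · simp

theorem coeff_polyOfCoeffs_of_notMem {k : Type*} [Field k] {n L : ℕ} (x : Exponents n L → k)
    {m : Fin n →₀ ℕ} (hm : ¬ (m.sum fun _ e => e) ≤ L) : coeff m (polyOfCoeffs k n L x) = 0 := by
  classical
  rw [polyOfCoeffs_apply, coeff_sum]
  refine Finset.sum_eq_zero fun m' _ => ?_
  rw [coeff_monomial, if_neg]
  rintro rfl
  exact hm m'.2

theorem polyOfCoeffs_injective (k : Type*) [Field k] (n L : ℕ) :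
    Function.Injective (polyOfCoeffs k n L) := fun x y h => funext fun m => by
  rw [← coeff_polyOfCoeffs x, h, coeff_polyOfCoeffs]

theorem mem_support_le_of_mem_restrictTotalDegree {k : Type*} [Field k] {n L : ℕ}
    {F : MvPolynomial (Fin n) k} (hF : F ∈ restrictTotalDegree (Fin n) k L) {m : Fin n →₀ ℕ}
    (hm : m ∈ F.support) : (m.sum fun _ e => e) ≤ L := hF hm

theorem range_polyOfCoeffs (k : Type*) [Field k] (n L : ℕ) :
    LinearMap.range (polyOfCoeffs k n L) = restrictTotalDegree (Fin n) k L := by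
  ext F
  constructor
  · rintro ⟨x, rfl⟩ m hm
    by_contra h
    exact mem_support_iff.mp hm (coeff_polyOfCoeffs_of_notMem x h)
  · intro hF
    refine ⟨fun m => coeff m.1 F, ?_⟩
    ext m
    by_cases hm : (m.sum fun _ e => e) ≤ L
    · exact coeff_polyOfCoeffs (fun m : Exponents n L => coeff m.1 F) ⟨m, hm⟩
    · rw [coeff_polyOfCoeffs_of_notMem _ hm]
      by_contra h
      exact hm (mem_support_le_of_mem_restrictTotalDegree hF (mem_support_iff.mpr (Ne.symm h)))

theorem polyOfCoeffs_mem_vanishingSpace_iff {k A : Type*} [Field k] [CharZero k] [CommRing A]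
    [Algebra k A] {n L T : ℕ} {S : Set (Fin n → A)} (x : Exponents n L → k) :
    polyOfCoeffs k n L x ∈ vanishingSpace k S L T ↔ ∀ α ∈ S, ∀ l : Fin n → ℕ, ∑ i, l i < T →
      ∑ m : Exponents n L, (((∏ i, (m.1 i).choose (l i) : ℕ) * ∏ i, α i ^ (m.1 i - l i)) *
        algebraMap k A (x m)) = 0 := by
  have h1 : polyOfCoeffs k n L x ∈ vanishingSpace k S L T ↔
      polyOfCoeffs k n L x ∈ restrictTotalDegree (Fin n) k L ∧
        ∀ α ∈ S, VanishesToOrder (polyOfCoeffs k n L x) α T := Iff.rfl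
  have h2 : polyOfCoeffs k n L x ∈ restrictTotalDegree (Fin n) k L :=
    range_polyOfCoeffs k n L ▸ LinearMap.mem_range_self _ x
  rw [h1, and_iff_right h2]
  refine forall₂_congr fun α _ => forall₂_congr fun l _ => ?_
  rw [polyOfCoeffs_apply, map_sum, map_sum]
  simp_rw [aeval_dividedDeriv_monomial]

theorem finrank_comap_polyOfCoeffs {k A : Type*} [Field k] [CommRing A]
    [Algebra k A] {n L T : ℕ} (S : Set (Fin n → A)) :
    finrank k ((vanishingSpace k S L T).comap (polyOfCoeffs k n L)) =
      finrank k (vanishingSpace k S L T) := by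
  have h : vanishingSpace k S L T ≤ LinearMap.range (polyOfCoeffs k n L) := by
    rw [range_polyOfCoeffs]
    exact fun F hF => hF.1
  rw [(Submodule.equivMapOfInjective _ (polyOfCoeffs_injective k n L)
    ((vanishingSpace k S L T).comap (polyOfCoeffs k n L))).finrank_eq, Submodule.map_comap_eq,
    inf_eq_right.mpr h]

end Polynomials

/-! ### Integral equations and their heights -/

section Rows

open Module NumberField NumberField.InfinitePlace

theorem exists_integral_coordinates {F : Type*} [Field F] [NumberField F] {n : ℕ} (x : Fin n → F) :
    ∃ y : Fin (n + 1) → 𝓞 F, y 0 ≠ 0 ∧ (fun i => (y i : F)) = (y 0 : F) • (Fin.cons 1 x) := by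
  obtain ⟨b, hb⟩ := IsLocalization.exist_integer_multiples (nonZeroDivisors (𝓞 F))
    Finset.univ x
  choose z hz using fun i => hb i (Finset.mem_univ i)
  refine ⟨Fin.cons b z, nonZeroDivisors.coe_ne_zero b, funext fun i => ?_⟩
  refine Fin.cases ?_ (fun i => ?_) i
  · simp
  · simpa [Algebra.smul_def] using hz i

/-- The integral coefficients of a linear form which is proportional to the evaluation of a divided
derivative, together with their heights in extension fields. -/
theorem exists_integral_row {F K : Type*} [Field F] [NumberField F] [Field K] [NumberField K]
    {n : ℕ} (x : Fin n → F) {θ : ℝ}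
    (hx : absLogHeight F (Fin.cons 1 x : Fin (n + 1) → F) ≤ θ) (l : Fin n → ℕ) (L T : ℕ)
    (hl : ∑ i, l i < T) :
    ∃ (a : Exponents n L → 𝓞 F) (c : F), c ≠ 0 ∧
      (∀ m, (a m : F) = c * ((∏ i, (m.1 i).choose (l i) : ℕ) * ∏ i, x i ^ (m.1 i - l i))) ∧
      ∀ τ : F →+* K, ∃ 𝔟 : Ideal (𝓞 K), (∀ m, RingOfIntegers.mapRingHom τ (a m) ∈ 𝔟) ∧
        ∏ w : InfinitePlace K, Real.sqrt (∑ m, w (τ (a m)) ^ 2) ^ w.mult ≤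
          (Real.sqrt (Fintype.card (Exponents n L)) * ((L : ℝ) + 1) ^ (T - 1) *
            Real.exp (L * θ)) ^ finrank ℚ K * Ideal.absNorm 𝔟 := by
  obtain ⟨y, hy0, hy⟩ := exists_integral_coordinates x
  have hy0' : (y 0 : F) ≠ 0 := by simpa using hy0
  have hys : ∀ i : Fin n, (y i.succ : F) = y 0 * x i := fun i => by
    simpa using congrFun hy i.succ
  have hs : ∀ m : Exponents n L, ∑ i, (m.1 i - l i) ≤ L := fun m =>
    (Finset.sum_le_sum fun i _ => Nat.sub_le _ _).trans (exponents_sum_le m)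
  -- Homogenise: with `y = y₀ (1, x)` integral, scaling the equation by `y₀ ^ L` makes each entry a
  -- binomial product times a monomial of degree exactly `L` in `y`. All entries then lie in `𝔠 ^
  -- L`, where `𝔠` is generated by the coordinates of `y`.
  refine ⟨fun m => (∏ i, (m.1 i).choose (l i) : ℕ) *
    (y 0 ^ (L - ∑ i, (m.1 i - l i)) * ∏ i, y i.succ ^ (m.1 i - l i)), (y 0 : F) ^ L,
    pow_ne_zero _ hy0', fun m => ?_, fun τ => ?_⟩
  · simp only [map_mul, map_natCast, map_pow, map_prod, hys, mul_pow, Finset.prod_mul_distrib,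
      Finset.prod_pow_eq_pow_sum]
    rw [← mul_assoc ((y 0 : F) ^ _), ← pow_add, Nat.sub_add_cancel (hs m)]
    ring
  let _ := τ.toAlgebra
  have hτ : ∀ z : 𝓞 F, RingOfIntegers.mapRingHom τ z = algebraMap (𝓞 F) (𝓞 K) z := fun z => rfl
  have hτ' : ∀ z : 𝓞 F, τ (z : F) = (algebraMap (𝓞 F) (𝓞 K) z : K) := fun z => rfl
  set 𝔠 : Ideal (𝓞 K) := Ideal.span (Set.range fun i => algebraMap (𝓞 F) (𝓞 K) (y i)) with h𝔠
  have hmem : ∀ i, algebraMap (𝓞 F) (𝓞 K) (y i) ∈ 𝔠 := fun i => Ideal.subset_span ⟨i, rfl⟩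
  refine ⟨𝔠 ^ L, fun m => ?_, ?_⟩
  · rw [hτ, map_mul, map_mul, map_pow, map_prod]
    refine Ideal.mul_mem_left _ _ ?_
    have h1 : ∏ i, algebraMap (𝓞 F) (𝓞 K) (y i.succ ^ (m.1 i - l i)) ∈
        𝔠 ^ ∑ i, (m.1 i - l i) := by
      rw [← Finset.prod_pow_eq_pow_sum]
      refine Ideal.prod_mem_prod fun i _ => ?_
      rw [map_pow]
      exact Ideal.pow_mem_pow (hmem _) _
    have h2 := Ideal.mul_mem_mul (Ideal.pow_mem_pow (hmem 0) (L - ∑ i, (m.1 i - l i))) h1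
    rwa [← pow_add, Nat.sub_add_cancel (hs m)] at h2
  have hS : ∀ (w : InfinitePlace K) i, w (algebraMap (𝓞 F) (𝓞 K) (y i) : K) ≤
      ⨆ i, w (algebraMap (𝓞 F) (𝓞 K) (y i) : K) := fun w i =>
    le_ciSup (Finite.bddAbove_range fun i => w (algebraMap (𝓞 F) (𝓞 K) (y i) : K)) i
  set S : InfinitePlace K → ℝ := fun w => ⨆ i, w (algebraMap (𝓞 F) (𝓞 K) (y i) : K)
  have hS0 : ∀ w, 0 ≤ S w := fun w => (apply_nonneg w _).trans (hS w 0)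
  -- Each binomial coefficient is at most `(L+1)^(l i)`, and the order of derivation is at most `T -
  -- 1`; here `T > 0` by `hl`.
  have hbin : ∀ m : Exponents n L, (∏ i, (m.1 i).choose (l i) : ℕ) ≤ (L + 1) ^ (T - 1) := fun m =>
    calc (∏ i, (m.1 i).choose (l i) : ℕ) ≤ ∏ i, (L + 1) ^ l i :=
          Finset.prod_le_prod' fun i _ => (Nat.choose_le_pow _ _).trans
            (Nat.pow_le_pow_left ((exponents_apply_le m i).trans (Nat.le_succ L)) _)
      _ = (L + 1) ^ ∑ i, l i := Finset.prod_pow_eq_pow_sum _ _ _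
      _ ≤ (L + 1) ^ (T - 1) := Nat.pow_le_pow_right (Nat.succ_pos L) (by omega)
  have hentry : ∀ (w : InfinitePlace K) (m : Exponents n L),
      w (τ (((∏ i, (m.1 i).choose (l i) : ℕ) *
        (y 0 ^ (L - ∑ i, (m.1 i - l i)) * ∏ i, y i.succ ^ (m.1 i - l i)) : 𝓞 F) : F)) ≤
        ((L : ℝ) + 1) ^ (T - 1) * S w ^ L := by
    intro w m
    rw [hτ']
    simp only [map_mul, map_natCast, map_pow, map_prod]
    refine mul_le_mul ?_ ?_ (by positivity) (by positivity)
    · refine (?_ : _ ≤ (((∏ i, (m.1 i).choose (l i) : ℕ) : ℕ) : ℝ)).trans (by exact_mod_cast hbin m)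
      rw [← norm_embedding_eq, map_natCast, Complex.norm_natCast]
    · have h1 : S w ^ L = S w ^ (L - ∑ i, (m.1 i - l i)) * ∏ i, S w ^ (m.1 i - l i) := by
        rw [Finset.prod_pow_eq_pow_sum, ← pow_add, Nat.sub_add_cancel (hs m)]
      rw [h1]
      refine mul_le_mul (pow_le_pow_left₀ (apply_nonneg w _) (hS w 0) _)
        (Finset.prod_le_prod (fun i _ => by positivity) fun i _ =>
          pow_le_pow_left₀ (apply_nonneg w _) (hS w _) _)
        (Finset.prod_nonneg fun i _ => by positivity) (pow_nonneg (hS0 w) _)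
  have hA : (0 : ℝ) ≤ ((L : ℝ) + 1) ^ (T - 1) := by positivity
  have hsqrt : ∀ (w : InfinitePlace K), Real.sqrt (∑ m : Exponents n L,
      w (τ (((∏ i, (m.1 i).choose (l i) : ℕ) *
        (y 0 ^ (L - ∑ i, (m.1 i - l i)) * ∏ i, y i.succ ^ (m.1 i - l i)) : 𝓞 F) : F)) ^ 2) ≤
        Real.sqrt (Fintype.card (Exponents n L)) * ((L : ℝ) + 1) ^ (T - 1) * S w ^ L := by
    intro w
    have h0 : 0 ≤ ((L : ℝ) + 1) ^ (T - 1) * S w ^ L := mul_nonneg hA (pow_nonneg (hS0 w) _)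
    rw [mul_assoc, ← Real.sqrt_sq h0, ← Real.sqrt_mul (Nat.cast_nonneg _)]
    refine Real.sqrt_le_sqrt ?_
    calc _ ≤ ∑ m : Exponents n L, (((L : ℝ) + 1) ^ (T - 1) * S w ^ L) ^ 2 :=
          Finset.sum_le_sum fun m _ => pow_le_pow_left₀ (apply_nonneg w _) (hentry w m) 2
      _ = _ := by rw [Finset.sum_const, Finset.card_univ, nsmul_eq_mul]
  have hyne : y ≠ 0 := fun h => hy0 (congrFun h 0)
  -- The height is unchanged by the scaling `y₀`, and `[K:ℚ] = [F:ℚ] [K:F]` converts the absolute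
  -- bound `θ` to `K`, whatever the embedding `τ`.
  have hheight : Height.mulHeight (fun i => (y i : F)) ^ finrank F K ≤
      Real.exp θ ^ finrank ℚ K := by
    have hd : (0 : ℝ) < finrank ℚ F := by exact_mod_cast finrank_pos
    rw [hy, Height.mulHeight_smul_eq_mulHeight _ hy0', ← finrank_mul_finrank ℚ F K, pow_mul]
    refine pow_le_pow_left₀ (Height.mulHeight_pos _).le ?_ _
    rw [absLogHeight, div_le_iff₀ hd, Height.logHeight_eq_log_mulHeight,
      Real.log_le_iff_le_exp (Height.mulHeight_pos _)] at hx
    rwa [← Real.exp_nat_mul, mul_comm]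
  calc _ ≤ ∏ w : InfinitePlace K, (Real.sqrt (Fintype.card (Exponents n L)) *
          ((L : ℝ) + 1) ^ (T - 1) * S w ^ L) ^ w.mult :=
        Finset.prod_le_prod (fun w _ => by positivity) fun w _ =>
          pow_le_pow_left₀ (Real.sqrt_nonneg _) (hsqrt w) _
    _ = (Real.sqrt (Fintype.card (Exponents n L)) * ((L : ℝ) + 1) ^ (T - 1)) ^ finrank ℚ K *
          (∏ w : InfinitePlace K, S w ^ w.mult) ^ L := by
        simp_rw [mul_pow _ (S _ ^ L), Finset.prod_mul_distrib, Finset.prod_pow_eq_pow_sum,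
          sum_mult_eq, ← pow_mul, mul_comm L, pow_mul, Finset.prod_pow]
    _ = (Real.sqrt (Fintype.card (Exponents n L)) * ((L : ℝ) + 1) ^ (T - 1)) ^ finrank ℚ K *
          (Height.mulHeight (fun i => (y i : F)) ^ finrank F K) ^ L * Ideal.absNorm (𝔠 ^ L) := by
        rw [prod_iSup_pow_mult_algebraMap hyne, mul_pow (_ ^ _) _ L, map_pow, Nat.cast_pow,
          ← mul_assoc]
    _ ≤ (Real.sqrt (Fintype.card (Exponents n L)) * ((L : ℝ) + 1) ^ (T - 1)) ^ finrank ℚ K *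
          (Real.exp θ ^ finrank ℚ K) ^ L * Ideal.absNorm (𝔠 ^ L) := by
        refine mul_le_mul_of_nonneg_right (mul_le_mul_of_nonneg_left (pow_le_pow_left₀
          (pow_nonneg (Height.mulHeight_pos _).le _) hheight _) (by positivity)) (by positivity)
    _ = _ := by
        rw [mul_pow _ (Real.exp (L * θ)), Real.exp_nat_mul, ← pow_mul, ← pow_mul,
          mul_comm L]

end Rows

/-! ### A Galois extension containing all coordinates -/

section SplittingField

open Module IntermediateField

/-- A finite Galois extension of `k` containing the coordinates of finitely many points. -/
theorem exists_isGalois_forall_field_hom {n : ℕ} (k : Type*) [Field k] [NumberField k]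
    [Algebra k QBar] {E : Set (Torus n)} (hE : E.Finite) :
    ∃ (K : Type) (_ : Field K) (_ : NumberField K) (_ : Algebra k K) (_ : IsGalois k K)
      (j : K →ₐ[k] QBar), ∀ α ∈ E, ∃ τ : α.field →+* K, ∀ x, j (τ x) = x := by
  have hint : ∀ x : QBar, IsIntegral k x := fun x =>
    (((AlgebraicClosure.isAlgebraic ℚ).isAlgebraic x).isIntegral).tower_top
  have halg : Algebra.IsAlgebraic k QBar := ⟨fun x => (hint x).isAlgebraic⟩
  have : IsAlgClosure k QBar := ⟨inferInstance, halg⟩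
  have : Normal k QBar := IsAlgClosure.normal k QBar
  set S : Set QBar := ⋃ α ∈ E, Set.range α.coords
  have hS : S.Finite := hE.biUnion fun α _ => Set.finite_range _
  have : Finite S := hS
  have : FiniteDimensional k (adjoin k S) := finiteDimensional_adjoin fun x _ => hint x
  let K : IntermediateField k QBar := normalClosure k (adjoin k S) QBar
  have hSK : adjoin k S ≤ K := le_normalClosure _
  have hfin : FiniteDimensional k K := normalClosure.is_finiteDimensional k (adjoin k S) QBar
  have : CharZero K := charZero_of_injective_algebraMap (algebraMap k K).injective
  have : FiniteDimensional ℚ K := Module.Finite.trans k K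
  have hnf : NumberField K := { }
  have : Normal k K := normalClosure.normal k (adjoin k S) QBar
  have hgal : IsGalois k K := { }
  refine ⟨K, inferInstance, hnf, inferInstance, hgal, K.val, fun α hα => ?_⟩
  have hle : ∀ x : α.field, (x : QBar) ∈ K := by
    have : α.field ≤ (K.restrictScalars ℚ) := by
      rw [adjoin_le_iff]
      rintro _ ⟨i, rfl⟩
      exact hSK (subset_adjoin k S (Set.mem_biUnion hα ⟨i, rfl⟩))
    exact fun x => this x.2
  exact ⟨α.field.val.toRingHom.codRestrict K.toSubfield hle, fun x => rfl⟩

end SplittingField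

/-! ### The vanishing conditions as a Galois stable system, and the final estimate -/

section Main

open Module NumberField NumberField.InfinitePlace MvPolynomial

theorem polyHeight_polyOfCoeffs_le {k : Type*} [Field k] [NumberField k] {n L : ℕ}
    {x : Exponents n L → 𝓞 k} (hx : x ≠ 0) {R : ℝ}
    (hR : ∀ (v : InfinitePlace k) m, v (x m) ≤ R) :
    polyHeight (polyOfCoeffs k n L fun m => (x m : k)) ≤ Real.log R := by
  set F := polyOfCoeffs k n L fun m => (x m : k) with hF
  have hle : ∀ m : F.support, (m.1.sum fun _ e => e) ≤ L := fun m =>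
    mem_support_le_of_mem_restrictTotalDegree
      (range_polyOfCoeffs k n L ▸ LinearMap.mem_range_self _ _) m.2
  have hcoeff : (fun m : F.support => F.coeff m) =
      fun m : F.support => ((x ⟨m, hle m⟩ : 𝓞 k) : k) :=
    funext fun m => coeff_polyOfCoeffs (fun m => (x m : k)) ⟨m, hle m⟩
  obtain ⟨m₀, hm₀⟩ := Function.ne_iff.mp hx
  have hm₀' : m₀.1 ∈ F.support := by
    rw [MvPolynomial.mem_support_iff, hF, coeff_polyOfCoeffs]
    simpa using hm₀
  rw [polyHeight, hcoeff]
  exact absLogHeight_le_log (x := fun m : F.support => x ⟨m, hle m⟩)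
    (Function.ne_iff.mpr ⟨⟨m₀.1, hm₀'⟩, hm₀⟩) fun v m => hR v _

theorem polyOfCoeffs_mem_range_map {k : Type*} [Field k] [NumberField k] {n L : ℕ}
    (x : Exponents n L → 𝓞 k) :
    polyOfCoeffs k n L (fun m => (x m : k)) ∈
      (MvPolynomial.map (σ := Fin n) (algebraMap (𝓞 k) k)).range :=
  ⟨∑ m : Exponents n L, monomial m.1 (x m), by
    rw [map_sum, polyOfCoeffs_apply]
    simp_rw [map_monomial]⟩

/-- The numerical hypothesis of Siegel's lemma for the conditions imposed by points of small
height. -/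
theorem siegel_bound {N n L T d r e M : ℕ} (hN : N ≤ (L + 1) ^ n) (hM : 0 < M) {θ c : ℝ}
    (hc : 0 < c) (hT : 0 < T ∨ r = 0) :
    Real.sqrt N ^ (d * r * e) * c ^ (d * M * e) *
        ((Real.sqrt N * ((L : ℝ) + 1) ^ (T - 1) * Real.exp (L * θ)) ^ (d * e)) ^ r ≤
      (Real.exp ((r : ℝ) / M * (((T : ℝ) + n - 1) * Real.log ((L : ℝ) + 1) + L * θ)) * c) ^
        (d * M * e) := by
  set W : ℝ := ((T : ℝ) + n - 1) * Real.log ((L : ℝ) + 1) + L * θ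
  have hexp : Real.exp ((r : ℝ) / M * W) ^ (d * M * e) = (Real.exp W ^ r) ^ (d * e) := by
    have hM' : (M : ℝ) ≠ 0 := by exact_mod_cast hM.ne'
    rw [← Real.exp_nat_mul, ← Real.exp_nat_mul, ← Real.exp_nat_mul]
    congr 1
    push_cast
    field_simp
  -- The `√N` of the projected box meets the `√N` of the row length, giving `N ≤ (L+1)^n`. For `T =
  -- 0` the exponent `T - 1` truncates, but then `r = 0` and both sides are 1.
  have hkey : (Real.sqrt N * (Real.sqrt N * ((L : ℝ) + 1) ^ (T - 1) * Real.exp (L * θ))) ^ r ≤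
      Real.exp W ^ r := by
    rcases hT with hT | rfl
    · refine pow_le_pow_left₀ (by positivity) ?_ r
      have hL : (0 : ℝ) < (L : ℝ) + 1 := by positivity
      have h1 : Real.exp W = ((L : ℝ) + 1) ^ (n + (T - 1)) * Real.exp (L * θ) := by
        rw [Real.exp_add, ← Real.exp_log (pow_pos hL (n + (T - 1))), Real.log_pow]
        congr 3
        rw [Nat.cast_add, Nat.cast_sub hT]
        push_cast
        ring
      rw [h1, mul_assoc (Real.sqrt N), ← mul_assoc, Real.mul_self_sqrt (Nat.cast_nonneg _),
        ← mul_assoc, pow_add]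
      gcongr
      exact_mod_cast hN
    · simp
  calc _ = ((Real.sqrt N * (Real.sqrt N * ((L : ℝ) + 1) ^ (T - 1) * Real.exp (L * θ))) ^ r) ^
          (d * e) * c ^ (d * M * e) := by ring
    _ ≤ (Real.exp W ^ r) ^ (d * e) * c ^ (d * M * e) := by
        gcongr
    _ = _ := by rw [← hexp, mul_pow]

/-- The vanishing conditions at finitely many points as a Galois stable family of linear forms. -/
theorem mem_comap_vanishingSpace_iff {k K : Type*} [Field k] [NumberField k] [Algebra k QBar]
    [Field K] [NumberField K] [Algebra k K] (j : K →ₐ[k] QBar) {n L T : ℕ} {E : Set (Torus n)}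
    (τ : ∀ α : E, α.1.field →+* K) (hτ : ∀ α x, j (τ α x) = x)
    (a : ∀ α : E, {l : Fin n → ℕ // ∑ i, l i < T} → Exponents n L → 𝓞 α.1.field)
    (c : ∀ α : E, {l : Fin n → ℕ // ∑ i, l i < T} → α.1.field) (hc : ∀ α l, c α l ≠ 0)
    (hac : ∀ α l m, (a α l m : α.1.field) =
      c α l * ((∏ i, (m.1 i).choose (l.1 i) : ℕ) * ∏ i, α.1.gen i ^ (m.1 i - l.1 i)))
    (x : Exponents n L → k) :
    x ∈ (vanishingSpace k (Torus.coords '' E) L T).comap (polyOfCoeffs k n L) ↔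
      ∀ p : (K ≃ₐ[k] K) × E × {l : Fin n → ℕ // ∑ i, l i < T}, ∑ m,
        (RingOfIntegers.mapRingHom ((p.1 : K →+* K).comp (τ p.2.1)) (a p.2.1 p.2.2 m) : K) *
          algebraMap k K (x m) = 0 := by
  -- As `x` has coordinates in `k`, the form conjugated by `σ` takes at `x` the value `σ` of a
  -- nonzero multiple of the original condition. Adding all conjugates makes the family stable
  -- without changing its zero set in `k ^ N`.
  have hsum : ∀ p : (K ≃ₐ[k] K) × E × {l : Fin n → ℕ // ∑ i, l i < T}, ∑ m,
      (RingOfIntegers.mapRingHom ((p.1 : K →+* K).comp (τ p.2.1)) (a p.2.1 p.2.2 m) : K) *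
        algebraMap k K (x m) = p.1 (τ p.2.1 (c p.2.1 p.2.2) * ∑ m : Exponents n L,
          τ p.2.1 (((∏ i, (m.1 i).choose (p.2.2.1 i) : ℕ) *
            ∏ i, p.2.1.1.gen i ^ (m.1 i - p.2.2.1 i))) * algebraMap k K (x m)) := by
    rintro ⟨σ, α, l⟩
    rw [Finset.mul_sum, map_sum]
    refine Finset.sum_congr rfl fun m _ => ?_
    have h1 : (RingOfIntegers.mapRingHom ((σ : K →+* K).comp (τ α)) (a α l m) : K) =
        σ (τ α (a α l m)) := rfl
    rw [h1, hac, map_mul (τ α), ← mul_assoc, map_mul σ _ (algebraMap k K _), σ.commutes]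
  have hjsum : ∀ (α : E) (l : Fin n → ℕ), j (∑ m : Exponents n L,
      τ α (((∏ i, (m.1 i).choose (l i) : ℕ) * ∏ i, α.1.gen i ^ (m.1 i - l i))) *
        algebraMap k K (x m)) = ∑ m : Exponents n L,
      (((∏ i, (m.1 i).choose (l i) : ℕ) * ∏ i, α.1.coords i ^ (m.1 i - l i)) *
        algebraMap k QBar (x m)) := by
    intro α l
    rw [map_sum]
    refine Finset.sum_congr rfl fun m _ => ?_
    rw [map_mul, j.commutes, hτ]
    congr 1
    push_cast
    rfl
  rw [Submodule.mem_comap, polyOfCoeffs_mem_vanishingSpace_iff]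
  constructor
  · rintro h ⟨σ, α, l⟩
    rw [hsum, (map_eq_zero_iff j j.injective).mp
      ((hjsum α l.1).trans (h _ ⟨α, α.2, rfl⟩ l.1 l.2)), mul_zero, map_zero]
  · rintro h _ ⟨α, hα, rfl⟩ l hl
    have h1 := h ⟨1, ⟨α, hα⟩, ⟨l, hl⟩⟩
    rw [hsum, map_eq_zero_iff _ (AlgEquiv.injective _), mul_eq_zero,
      map_eq_zero_iff _ (τ ⟨α, hα⟩).injective, or_iff_right (hc _ _)] at h1
    rw [← hjsum ⟨α, hα⟩ l, h1, map_zero]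

/-- The vanishing conditions at finitely many points of small height, as a Galois stable family of
linear forms with integral coefficients and small heights. -/
theorem exists_rows {k K : Type*} [Field k] [NumberField k] [Algebra k QBar]
    [Field K] [NumberField K] [Algebra k K] (j : K →ₐ[k] QBar) {n : ℕ} (L T : ℕ) {E : Set (Torus n)}
    {θ : ℝ} (hE : ∀ α ∈ E, α.height ≤ θ) (hj : ∀ α ∈ E, ∃ τ : α.field →+* K, ∀ x, j (τ x) = x) :
    ∃ A : (K ≃ₐ[k] K) × E × {l : Fin n → ℕ // ∑ i, l i < T} → Exponents n L → 𝓞 K,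
      (∀ x, x ∈ (vanishingSpace k (Torus.coords '' E) L T).comap (polyOfCoeffs k n L) ↔
        ∀ p, ∑ m, (A p m : K) * algebraMap k K (x m) = 0) ∧
      (∀ (σ : K ≃ₐ[k] K) p, ∃ p', ∀ m, (A p' m : K) = σ (A p m)) ∧
      ∀ p, ∃ 𝔟 : Ideal (𝓞 K), (∀ m, A p m ∈ 𝔟) ∧
        ∏ w : InfinitePlace K, Real.sqrt (∑ m, w (A p m) ^ 2) ^ w.mult ≤
          (Real.sqrt (Fintype.card (Exponents n L)) * ((L : ℝ) + 1) ^ (T - 1) *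
            Real.exp (L * θ)) ^ finrank ℚ K * Ideal.absNorm 𝔟 := by
  choose τ hτ using fun α : E => hj α.1 α.2
  choose a c hc hac hb using fun (α : E) (l : {l : Fin n → ℕ // ∑ i, l i < T}) =>
    exists_integral_row (K := K) α.1.gen (hE α.1 α.2) l.1 L T l.2
  refine ⟨fun p m => RingOfIntegers.mapRingHom ((p.1 : K →+* K).comp (τ p.2.1)) (a p.2.1 p.2.2 m),
    mem_comap_vanishingSpace_iff j τ hτ a c hc hac, fun σ p => ⟨⟨p.1.trans σ, p.2⟩, fun m => rfl⟩,
    fun p => hb p.2.1 p.2.2 ((p.1 : K →+* K).comp (τ p.2.1))⟩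

end Main

end SiegelTorus

end

open SiegelTorus Module NumberField in
theorem mainTheorem6 {n : ℕ} (k : Type*) [Field k] [NumberField k] [Algebra k SiegelTorus.QBar]
    (θ : ℝ) (hθ : 0 < θ)
    (E : Set (SiegelTorus.Torus n)) (hEfin : E.Finite) (hEne : E.Nonempty)
    (hE : ∀ α ∈ E, α.height ≤ θ) (L T : ℕ)
    (hne : SiegelTorus.vanishingSpace k (SiegelTorus.Torus.coords '' E) L T ≠ ⊥) :
    ∃ F ∈ SiegelTorus.vanishingSpace k (SiegelTorus.Torus.coords '' E) L T,
      F ∈ (MvPolynomial.map (σ := Fin n)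
        (algebraMap (NumberField.RingOfIntegers k) k)).range ∧
      F ≠ 0 ∧
      SiegelTorus.polyHeight F ≤
        (SiegelTorus.codimVanishing k (SiegelTorus.Torus.coords '' E) L T : ℝ) /
            ((SiegelTorus.dimPoly k n L : ℝ) -
              (SiegelTorus.codimVanishing k (SiegelTorus.Torus.coords '' E) L T : ℝ)) *
          (((T : ℝ) + (n : ℝ) - 1) * Real.log ((L : ℝ) + 1) + (L : ℝ) * θ) +
        Real.log (SiegelTorus.fieldConst k) := by
  obtain ⟨K, _, _, _, _, j, hj⟩ := exists_isGalois_forall_field_hom k hEfin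
  obtain ⟨A, hV, hAG, hA⟩ := exists_rows j L T hE hj
  choose 𝔟 hAb hAH using hA
  set V := (vanishingSpace k (Torus.coords '' E) L T).comap (polyOfCoeffs k n L)
  have hfin : finrank k V = finrank k (vanishingSpace k (Torus.coords '' E) L T) :=
    finrank_comap_polyOfCoeffs _
  have hVN : finrank k V ≤ Fintype.card (Exponents n L) := by
    simpa using Submodule.finrank_le V
  have hV0 : 0 < finrank k V := by
    rw [hfin]
    have : FiniteDimensional k (vanishingSpace k (Torus.coords '' E) L T) :=
      Submodule.finiteDimensional_of_le
        (S₂ := MvPolynomial.restrictTotalDegree (Fin n) k L) fun F hF => hF.1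
    have := Submodule.nontrivial_iff_ne_bot.mpr hne
    exact finrank_pos
  set r := codimVanishing k (Torus.coords '' E) L T with hr
  have hrV : r + finrank k V = Fintype.card (Exponents n L) := by
    rw [hr, codimVanishing, dimPoly_eq_card, ← hfin]
    omega
  have hNr : (dimPoly k n L : ℝ) - (r : ℝ) = finrank k V := by
    rw [dimPoly_eq_card, ← hrV]
    push_cast
    ring
  have hR : 0 < Real.exp ((r : ℝ) / (finrank k V : ℕ) *
      (((T : ℝ) + n - 1) * Real.log ((L : ℝ) + 1) + L * θ)) * fieldConst k :=
    mul_pos (Real.exp_pos _) (fieldConst_pos k)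
  -- A row carries a multi-index of weight less than `T`, so the existence of one forces `T > 0`;
  -- otherwise `r = 0`.
  have hbound : Nonempty ((K ≃ₐ[k] K) × E × {l : Fin n → ℕ // ∑ i, l i < T}) ∨ r = 0 →
      Real.sqrt (Fintype.card (Exponents n L)) ^ (finrank ℚ k * r * finrank k K) *
        fieldConst k ^ (finrank ℚ k * finrank k V * finrank k K) *
          ((Real.sqrt (Fintype.card (Exponents n L)) * ((L : ℝ) + 1) ^ (T - 1) *
            Real.exp (L * θ)) ^ finrank ℚ K) ^ r ≤
        (Real.exp ((r : ℝ) / (finrank k V : ℕ) *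
          (((T : ℝ) + n - 1) * Real.log ((L : ℝ) + 1) + L * θ)) * fieldConst k) ^
            (finrank ℚ k * finrank k V * finrank k K) := by
    intro h
    rw [← finrank_mul_finrank ℚ k K]
    refine siegel_bound (card_exponents_le n L) hV0 (fieldConst_pos k) (h.imp_left ?_)
    rintro ⟨p⟩
    exact (Nat.zero_le _).trans_lt p.2.2.2
  obtain ⟨x, hx0, hxV, hxR⟩ := exists_integral_vector_mem_le A hV hAG _ hAb _ hAH hV0 hrV hR hbound
  refine ⟨polyOfCoeffs k n L fun m => (x m : k), hxV, polyOfCoeffs_mem_range_map x, ?_, ?_⟩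
  · intro h0
    apply hx0
    ext m
    have := coeff_polyOfCoeffs (fun m => (x m : k)) m
    rw [h0, MvPolynomial.coeff_zero] at this
    simpa using this.symm
  · refine (polyHeight_polyOfCoeffs_le hx0 hxR).trans_eq ?_
    rw [Real.log_mul (Real.exp_pos _).ne' (fieldConst_pos k).ne', Real.log_exp, hNr]
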